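/- Let $(M,g)$ be a Riemannian manifold and let $G$ be a Lie group acting on $M$ smoothly, effectively, properly and by isometries (i.e. as a closed group of isometries), with connected orbit space $M/G$, such that every orbit is principal and of codimension one. Let $\xi$ be a smooth $G$-equivariant unit vector field on $M$ orthogonal to all the orbits, assume that $\xi$ is complete (which is automatic if $M$ is complete), and let $(\varphi_t)_{t\in\mathbb R}$ be its flow, with one-parameter group $A$. The group $A\times G$ acts on $M$ by $(t,h)\cdot x=\varphi_t(h\cdot x)=h\cdot\varphi_t(x)$. For $X$ in the Lie algebra $\mathfrak g$ of $G$, let $X^*$ be the fundamental vector field $X^*_x=\frac{d}{ds}\big|_{s=0}\exp(sX)\cdot x$. Fix $p\in M$, put $\gamma(t)=\varphi_t(p)$, let $\mathfrak h=\{X\in\mathfrak g: X^*_p=0\}$ be the Lie algebra of the isotropy group of $p$ in $G$, and let $\mathfrak m\subset\mathfrak g$ be a linear subspace with $\mathfrak g=\mathfrak h\oplus\mathfrak m$ and $\mathrm{Ad}(h)\mathfrak m\subset\mathfrak m$ whenever $\varphi_t(h\cdot p)=p$ for some $t$; so $\mathfrak a+\mathfrak g=\mathfrak h+(\mathfrak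 a+\mathfrak m)$ is a reductive decomposition at $p$ for the action of $A\times G$, where $\mathfrak a$ is the Lie algebra of $A$. Write $V_{\mathfrak m}$ for the $\mathfrak m$-component of $V\in\mathfrak g$, and $\varphi_{t*}V=(d\varphi_t)_p(V^*_p)$ for $V\in\mathfrak m$. Let $\nabla$ be the Levi-Civita connection of $M$ and let $\tilde\nabla$ be the canonical connection of this reductive decomposition, i.e. the $A\times G$-invariant affine connection such that $(\tilde\nabla_{U^*}W)_p=[U^*,W]_p$ for all $U\in\mathfrak a+\mathfrak m$ and all vector fields $W$, where $(a,X)^*=a\xi+X^*$ for $a\in\mathbb R\cong\mathfrak a$ and $X\in\mathfrak m$. Let $S=\nabla-\tilde\nabla$, a tensor of type $(1,2)$ (the canonical cohomogeneity one structure). Then, for all $X,Y,Z\in\mathfrak m$ and $a,b,c,t\in\mathbb R$: 1. $(\tilde\nabla_{X^*}\xi)_{\gamma(t)}=(\tilde\nabla_\xi X^*)_{\gamma(t)}=(\tilde\nabla_\xi\xi)_{\gamma(t)}=0$ and $(\tilde\nabla_{X^*}Y^*)_{\gamma(t)}=-\varphi_{t*}[X,Y]_{\mathfrak m}$. 2.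 The function $t\mapsto g(\varphi_{t*}X,\varphi_{t*}Y)$ is differentiable, and \begin{align*} 2g\big(S_{a\xi+X^*}(b\xi+Y^*),\,c\xi+Z^*\big)_{\gamma(t)}={} &a\frac{d}{dt}g(\varphi_{t*}Y,\varphi_{t*}Z)+b\frac{d}{dt}g(\varphi_{t*}X,\varphi_{t*}Z)-c\frac{d}{dt}g(\varphi_{t*}X,\varphi_{t*}Y)\\ &+g(\varphi_{t*}[X,Y]_{\mathfrak m},\varphi_{t*}Z)-g(\varphi_{t*}[X,Z]_{\mathfrak m},\varphi_{t*}Y)-g(\varphi_{t*}[Y,Z]_{\mathfrak m},\varphi_{t*}X). \end{align*} -/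

import Mathlib

open Bundle VectorField
open scoped Manifold ContDiff

noncomputable section

namespace CohomogeneityOne

variable {EG : Type*} [NormedAddCommGroup EG] [NormedSpace ℝ EG]
  {HG : Type*} [TopologicalSpace HG] (J : ModelWithCorners ℝ EG HG)
  {G : Type*} [TopologicalSpace G] [ChartedSpace HG G] [Group G]
  {E : Type*} [NormedAddCommGroup E] [NormedSpace ℝ E]
  {H : Type*} [TopologicalSpace H] (I : ModelWithCorners ℝ E H)
  {M : Type*} [TopologicalSpace M] [ChartedSpace H M] [IsManifold I ∞ M]
  [MulAction G M]

/-- The fundamental vector field `X*` on `M` of an element `X` of the Lie algebra of `G`: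
`X*` at `x` is the image of `X` under the derivative at `1` of the orbit map `g ↦ g • x`
(that is, the velocity at time `0` of `exp (s X) • x`). -/
def fundamentalField (X : GroupLieAlgebra J G) (x : M) : TangentSpace I x :=
  mfderiv J I (fun g : G ↦ g • x) 1 X

/-- The adjoint representation `Ad g` of `G` on its Lie algebra: the derivative at `1` of the
conjugation `h ↦ g h g⁻¹`. -/
def Ad (g : G) (X : GroupLieAlgebra J G) : GroupLieAlgebra J G :=
  mfderiv J J (fun h : G ↦ g * h * g⁻¹) 1 X

/-- The Lie algebra `𝔥` of the isotropy group of `p`: the kernel of `X ↦ X*_p`, i.e. of the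
derivative at `1` of the orbit map `g ↦ g • p`. -/
def isotropyAlgebra (p : M) : Submodule ℝ (GroupLieAlgebra J G) :=
  (mfderiv J I (fun g : G ↦ g • p) 1).toLinearMap.ker

variable (G) in
/-- The orbit of `p` is principal: up to conjugation, the isotropy group of `p` is contained in
every isotropy group of the action (note that the isotropy group of `g • p` is
`g Isot(p) g⁻¹`). -/
def IsPrincipalOrbit (p : M) : Prop :=
  ∀ q : M, ∃ g : G, MulAction.stabilizer G (g • p) ≤ MulAction.stabilizer G q

variable (G M) in
/-- `M` is a regular cohomogeneity one Riemannian manifold under the (smooth) action of the Lie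
group `G`: `G` acts as a closed group of isometries (effectively, properly and by isometries), the
orbit space is connected, and every orbit is principal and of codimension one. The dimension of the
orbit through `x` is the rank at `1` of the orbit map `g ↦ g • x`. -/
structure IsRegularCohomogeneityOne [RiemannianBundle (fun x : M ↦ TangentSpace I x)] : Prop where
  faithful : FaithfulSMul G M
  proper : ProperSMul G M
  isometric : ∀ (g : G) (x : M) (v w : TangentSpace I x),
    inner ℝ (mfderiv I I (fun y : M ↦ g • y) x v) (mfderiv I I (fun y : M ↦ g • y) x w)
      = inner ℝ v w
  connected : ConnectedSpace (MulAction.orbitRel.Quotient G M)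
  principal : ∀ x : M, IsPrincipalOrbit G x
  codim_one : ∀ x : M,
    Module.finrank ℝ (mfderiv J I (fun g : G ↦ g • x) 1).toLinearMap.range + 1 = Module.finrank ℝ E

variable (G) in
/-- `ξ` is a smooth `G`-equivariant unit vector field on `M` which is orthogonal to all the
orbits of `G`. -/
structure IsUnitNormalField [RiemannianBundle (fun x : M ↦ TangentSpace I x)]
    (ξ : Π x : M, TangentSpace I x) : Prop where
  smooth : ContMDiff I I.tangent ∞ (fun x ↦ (⟨x, ξ x⟩ : TangentBundle I M))
  unit : ∀ x, inner ℝ (ξ x) (ξ x) = (1 : ℝ)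
  normal : ∀ (X : GroupLieAlgebra J G) (x : M), inner ℝ (fundamentalField J I X x) (ξ x) = (0 : ℝ)
  equivariant : ∀ (g : G) (x : M), mfderiv I I (fun y : M ↦ g • y) x (ξ x) = ξ (g • x)

/-- `φ` is the (globally defined) flow of the vector field `ξ`. -/
structure IsGlobalFlow (ξ : Π x : M, TangentSpace I x) (φ : ℝ → M → M) : Prop where
  map_zero : ∀ x, φ 0 x = x
  integralCurve : ∀ x, IsMIntegralCurve (I := I) (fun t ↦ φ t x) ξ

/-- `𝔪` is a reductive complement at `p` for the group `A × G`, where `A` is the one-parameter group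
`φ`, acting on `M` by `(t, g) · x = φ_t (g • x)`: one has `𝔤 = 𝔥 ⊕ 𝔪`, and `𝔪` (equivalently
`𝔞 + 𝔪`, as `A` is central) is invariant under `Ad` of the isotropy group of `p` in `A × G`. -/
structure IsReductiveComplement (φ : ℝ → M → M) (p : M)
    (𝔪 : Submodule ℝ (GroupLieAlgebra J G)) : Prop where
  isCompl : IsCompl 𝔪 (isotropyAlgebra J I p)
  ad_mem : ∀ (t : ℝ) (g : G), φ t (g • p) = p → ∀ X ∈ 𝔪, Ad J g X ∈ 𝔪

/-- The `𝔪`-component of an element of `𝔤 = 𝔥 ⊕ 𝔪`. -/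
def mComponent {φ : ℝ → M → M} {p : M} {𝔪 : Submodule ℝ (GroupLieAlgebra J G)}
    (h𝔪 : IsReductiveComplement J I φ p 𝔪) (X : GroupLieAlgebra J G) : GroupLieAlgebra J G :=
  Submodule.projection 𝔪 (isotropyAlgebra J I p) h𝔪.isCompl X

/-- The push-forward `φ_{t*p} X` of `X ∈ 𝔪`, where `X` is identified with the tangent vector `X*_p`
at `p`. -/
def push (φ : ℝ → M → M) (p : M) (t : ℝ) (X : GroupLieAlgebra J G) : TangentSpace I (φ t p) :=
  mfderiv I I (φ t) p (fundamentalField J I X p)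

/-- The vector field `a ξ + X*`, i.e. the fundamental vector field of the element `(a, X)` of the
Lie algebra `𝔞 + 𝔤` of `A × G`. -/
def actionField (ξ : Π x : M, TangentSpace I x) (a : ℝ) (X : GroupLieAlgebra J G) (x : M) :
    TangentSpace I x :=
  a • ξ x + fundamentalField J I X x

/-- The affine connection `cov` is invariant under the diffeomorphism `F` of `M`:
`F_* (∇_v (F^* Y)) = ∇_{F_* v} Y` (recall that `cov Y x v` stands for `∇_v Y`). -/
def IsInvariantUnder (cov : CovariantDerivative I E (TangentSpace I : M → Type _))
    (F : M → M) : Prop :=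
  ∀ (Y : Π x : M, TangentSpace I x) (x : M) (v : TangentSpace I x),
    MDifferentiableAt I I.tangent (fun y ↦ (⟨y, Y y⟩ : TangentBundle I M)) (F x) →
    mfderiv I I F x (cov (mpullback I I F Y) x v) = cov Y (F x) (mfderiv I I F x v)

/-- `cov` is the canonical connection of the homogeneous space `M` of `A × G` with respect to the
reductive decomposition `𝔞 + 𝔤 = 𝔥 + (𝔞 + 𝔪)` at `p`: it is `A × G`-invariant, and
`(∇_{U*} Y)_p = [U*, Y]_p` for all `U ∈ 𝔞 + 𝔪` and all vector fields `Y` (i.e. its Nomizu map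
`U ↦ (∇_{U*} - L_{U*})_p` vanishes on `𝔞 + 𝔪`). -/
structure IsCanonicalConnection (ξ : Π x : M, TangentSpace I x) (φ : ℝ → M → M) (p : M)
    (𝔪 : Submodule ℝ (GroupLieAlgebra J G))
    (cov : CovariantDerivative I E (TangentSpace I : M → Type _)) : Prop where
  invariant : ∀ (t : ℝ) (g : G), IsInvariantUnder I cov (fun x ↦ φ t (g • x))
  nomizu : ∀ (a : ℝ), ∀ X ∈ 𝔪, ∀ Y : Π x : M, TangentSpace I x,
    MDifferentiableAt I I.tangent (fun y ↦ (⟨y, Y y⟩ : TangentBundle I M)) p →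
    cov Y p (actionField J I ξ a X p) = mlieBracket I (actionField J I ξ a X) Y p

/-- `cov` is the Levi-Civita connection of `M`: it is torsion-free, and it is metric, i.e.
`v ⟨Y, Z⟩ = ⟨∇_v Y, Z⟩ + ⟨Y, ∇_v Z⟩`. -/
structure IsLeviCivita [FiniteDimensional ℝ E]
    [RiemannianBundle (fun x : M ↦ TangentSpace I x)]
    (cov : CovariantDerivative I E (TangentSpace I : M → Type _)) : Prop where
  torsion_free : cov.torsion = 0
  metric : ∀ (Y Z : Π x : M, TangentSpace I x) (x : M) (v : TangentSpace I x),
    MDifferentiableAt I I.tangent (fun y ↦ (⟨y, Y y⟩ : TangentBundle I M)) x →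
    MDifferentiableAt I I.tangent (fun y ↦ (⟨y, Z y⟩ : TangentBundle I M)) x →
    mvfderiv I (fun y : M ↦ inner ℝ (Y y) (Z y)) x v
      = inner ℝ (cov Y x v) (Z x) + inner ℝ (Y x) (cov Z x v)

end CohomogeneityOne

end

/-!
Along the normal geodesic `γ(t) = φ_t(p)` every vector in the statement is the value of one of the
vector fields `a ξ + X*` (`actionField`), so the whole computation takes place with these fields.

Brackets. `[X*, ξ] = 0` because `ξ` is equivariant
(`mlieBracket_fundamentalField_of_equivariant`), and `[X*, Y*] = -[X, Y]*`
(`mlieBracket_fundamentalField`). Both follow from a Lie derivative formula that does not need a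
flow: if `b_s` is a `C²` family of maps with `b_0 = id` and initial velocity field `A`, then the
derivative at `s = 0` of the pullback of a field `V` under `b_s` is `[A, V]`
(`hasDerivAt_mpullback_family`). It is applied to `b_s(x) = c(s) • x` with `c` an arbitrary curve in
the group through `1` with velocity `X`, so the exponential map plays no role; applied to
`b_s(h) = h c(s)` on the group, it says that the differential of `Ad` is the bracket
(`hasDerivAt_Ad`). The same formula and the invariance of the metric give the Killing equation
`X*⟨V, W⟩ = ⟨[X*, V], W⟩ + ⟨V, [X*, W]⟩` (`mvfderiv_inner_fundamentalField`).

The flow. Uniqueness of integral curves shows that `φ` is a one-parameter group commuting with `G`.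
Differentiability of `φ_t` comes from the geometry instead of the general theory of flows: as `ξ` is
transverse to the orbits, which have codimension one, a neighbourhood of `x` consists of points
`g • φ_s(x)`, with `s` and `g` depending differentiably on the point
(`exists_orbit_coordinates`), and `φ_t` maps `g • φ_s(x)` to `g • φ_{t+s}(x)`
(`mdifferentiableAt_flow`). Hence `φ_t` preserves `ξ` and all the `X*`; in particular
`φ_{t*} X = X*` at `γ(t)`.

The connections. The canonical connection satisfies `∇_U V = [U, V]` at `p` for `U = a ξ + X*`
with `X ∈ 𝔪` and `V = b ξ + Y*`. As it is invariant under `φ_t`, the equality propagates to `γ(t)`,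
where `[U, V] = -[X, Y]*` (`IsCanonicalConnection.actionField`). The Levi-Civita connection on these
fields is given by Koszul's formula (`IsLeviCivita.inner_actionField`). The difference of the two
is the formula for `S`.

`TangentSpace I x` is by definition the model space `E`. Equalities of tangent vectors whose base
points agree only propositionally, such as `1 • x` and `x`, are stated in `E`, by ascriptions
`(_ : E)`.
-/

/-! ### The Lie derivative in a vector space and local sections -/

section VectorSpace

open Filter Topology

variable {E : Type*} [NormedAddCommGroup E] [NormedSpace ℝ E]

/-- The Lie derivative formula in a vector space: if `F (s, ·)` is a `C²` family of maps with
`F (0, ·) = id` and `T s` is the pullback of the vector field `V` under `F (s, ·)`, evaluated at the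
fixed point `x`, then `T` is differentiable at `0` and its derivative is the Lie bracket of the
initial velocity field of the family with `V`. -/
theorem hasDerivAt_pullback_family [CompleteSpace E] {F : ℝ × E → E} {V : E → E} {T : ℝ → E} {x : E}
    (hF : ContDiffAt ℝ 2 F (0, x)) (h0 : ∀ᶠ y in 𝓝 x, F (0, y) = y)
    (hV : DifferentiableAt ℝ V x)
    (hT : ∀ᶠ s in 𝓝 (0 : ℝ), fderiv ℝ (fun y ↦ F (s, y)) x (T s) = V (F (s, x))) :
    HasDerivAt T (lieBracket ℝ (fun y ↦ deriv (fun s ↦ F (s, y)) 0) V x) 0 := by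
  have hFx : F (0, x) = x := h0.self_of_nhds
  have hd : ∀ᶠ q in 𝓝 ((0 : ℝ), x), DifferentiableAt ℝ F q :=
    (hF.eventually (by simp)).mono fun q hq ↦ hq.differentiableAt (by simp)
  have hs_cont : Tendsto (fun s : ℝ ↦ (s, x)) (𝓝 0) (𝓝 (0, x)) :=
    (Continuous.prodMk_left x).tendsto 0
  have hy_cont : Tendsto (fun y : E ↦ ((0 : ℝ), y)) (𝓝 x) (𝓝 (0, x)) :=
    (Continuous.prodMk_right (0 : ℝ)).tendsto x
  have hDF : DifferentiableAt ℝ (fderiv ℝ F) (0, x) :=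
    (hF.fderiv_right (m := 1) (by norm_num)).differentiableAt (by simp)
  set D2 := fderiv ℝ (fderiv ℝ F) (0, x) with hD2
  have hsymm : IsSymmSndFDerivAt ℝ F (0, x) := hF.isSymmSndFDerivAt (by simp)
  have hpart : ∀ q, DifferentiableAt ℝ F q →
      fderiv ℝ (fun y ↦ F (q.1, y)) q.2 = (fderiv ℝ F q) ∘L (ContinuousLinearMap.inr ℝ ℝ E) := by
    intro q hq
    exact (hq.hasFDerivAt.comp q.2 (hasFDerivAt_prodMk_right q.1 q.2)).fderiv
  have hpart1 : ∀ q, DifferentiableAt ℝ F q →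
      HasDerivAt (fun s ↦ F (s, q.2)) (fderiv ℝ F q (1, 0)) q.1 := by
    intro q hq
    have := (hq.hasFDerivAt.comp q.1 (hasFDerivAt_prodMk_left q.1 q.2)).hasDerivAt
    simpa using! this
  -- the partial derivative of `F` in the direction of the space variable, along the `s`-axis
  let P : ℝ → E →L[ℝ] E := fun s ↦ (fderiv ℝ F (s, x)) ∘L (ContinuousLinearMap.inr ℝ ℝ E)
  have hline : HasDerivAt (fun s : ℝ ↦ (s, x)) ((1 : ℝ), (0 : E)) 0 :=
    (hasDerivAt_id (0 : ℝ)).prodMk (hasDerivAt_const _ _)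
  have hP : HasDerivAt P ((D2 (1, 0)) ∘L (ContinuousLinearMap.inr ℝ ℝ E)) 0 := by
    have h1 : HasDerivAt (fun s : ℝ ↦ fderiv ℝ F (s, x)) (D2 (1, 0)) 0 :=
      HasFDerivAt.comp_hasDerivAt (x := (0 : ℝ)) (f := fun s : ℝ ↦ (s, x)) hDF.hasFDerivAt hline
    simpa using h1.clm_comp (hasDerivAt_const (0 : ℝ) (ContinuousLinearMap.inr ℝ ℝ E))
  have hP0 : P 0 = ContinuousLinearMap.id ℝ E := by
    have h1 := hpart (0, x) hd.self_of_nhds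
    have h2 : (fun y ↦ F (0, y)) =ᶠ[𝓝 x] id := h0
    rw [h2.fderiv_eq, fderiv_id] at h1
    exact h1.symm
  have hR : HasDerivAt (fun s ↦ V (F (s, x))) (fderiv ℝ V x (fderiv ℝ F (0, x) (1, 0))) 0 := by
    have h1 := hpart1 (0, x) hd.self_of_nhds
    have hV' : HasFDerivAt V (fderiv ℝ V x) (F (0, x)) := by rw [hFx]; exact hV.hasFDerivAt
    exact hV'.comp_hasDerivAt (0 : ℝ) h1
  have hPT : ∀ᶠ s in 𝓝 (0 : ℝ), P s (T s) = V (F (s, x)) := by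
    filter_upwards [hT, hs_cont.eventually hd] with s h1 h2
    rw [hpart (s, x) h2] at h1
    exact h1
  have hinv : ∀ᶠ s in 𝓝 (0 : ℝ), (P s).IsInvertible := by
    have : ∀ᶠ A in 𝓝 (P 0), ContinuousLinearMap.IsInvertible A := by
      rw [hP0]
      exact ContinuousLinearEquiv.nhds (ContinuousLinearEquiv.refl ℝ E)
    exact hP.continuousAt.eventually this
  have hTe : T =ᶠ[𝓝 0] fun s ↦ (P s).inverse (V (F (s, x))) := by
    filter_upwards [hinv, hPT] with s h1 h2
    rw [← h2]
    obtain ⟨e, he⟩ := h1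
    rw [← he]
    simp
  have hTd : DifferentiableAt ℝ T 0 := by
    rw [hTe.differentiableAt_iff]
    have h1 : DifferentiableAt ℝ ContinuousLinearMap.inverse (P 0) :=
      (ContinuousLinearMap.IsInvertible.contDiffAt_map_inverse (n := 1)
        hinv.self_of_nhds).differentiableAt (by simp)
    exact (h1.comp (0 : ℝ) hP.differentiableAt).clm_apply hR.differentiableAt
  have hT0 : T 0 = V x := by
    have := hPT.self_of_nhds
    rw [hP0, hFx] at this
    exact this
  have hprod := hP.clm_apply hTd.hasDerivAt
  have heq : (fun s ↦ P s (T s)) =ᶠ[𝓝 0] fun s ↦ V (F (s, x)) := hPT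
  have huniq := hprod.unique (hR.congr_of_eventuallyEq heq)
  rw [hP0, hT0] at huniq
  -- the initial velocity field and its derivative
  have hA : (fun y ↦ deriv (fun s ↦ F (s, y)) 0) =ᶠ[𝓝 x] fun y ↦ fderiv ℝ F (0, y) (1, 0) := by
    filter_upwards [hy_cont.eventually hd] with y hy
    exact (hpart1 (0, y) hy).deriv
  have hA' : HasFDerivAt (fun y ↦ fderiv ℝ F (0, y) (1, 0))
      ((ContinuousLinearMap.apply ℝ E ((1 : ℝ), (0 : E))) ∘L D2 ∘L
        (ContinuousLinearMap.inr ℝ ℝ E)) x := by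
    have h1 : HasFDerivAt (fun y : E ↦ fderiv ℝ F (0, y))
        (D2 ∘L (ContinuousLinearMap.inr ℝ ℝ E)) x :=
      hDF.hasFDerivAt.comp x (hasFDerivAt_prodMk_right (0 : ℝ) x)
    exact (ContinuousLinearMap.apply ℝ E ((1 : ℝ), (0 : E))).hasFDerivAt.comp x h1
  have hfin : lieBracket ℝ (fun y ↦ deriv (fun s ↦ F (s, y)) 0) V x = deriv T 0 := by
    rw [lieBracket, hA.fderiv_eq, hA'.fderiv, (hpart1 (0, x) hd.self_of_nhds).deriv]
    have h3 := hsymm.eq ((1 : ℝ), (0 : E)) ((0 : ℝ), V x)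
    simp only [ContinuousLinearMap.comp_apply, ContinuousLinearMap.inr_apply,
      ContinuousLinearMap.apply_apply, ContinuousLinearMap.id_apply] at huniq ⊢
    rw [← huniq, ← h3]
    simp [hD2]
  rw [hfin]
  exact hTd.hasDerivAt

/-- A strictly differentiable map with surjective derivative has a local section which is
differentiable at the image point. -/
theorem HasStrictFDerivAt.exists_section {F : Type*} [NormedAddCommGroup F] [NormedSpace ℝ F]
    [FiniteDimensional ℝ F] {f : E → F} {f' : E →L[ℝ] F} {a : E}
    (hf : HasStrictFDerivAt f f' a) (hsurj : Function.Surjective f') :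
    ∃ σ : F → E, σ (f a) = a ∧ DifferentiableAt ℝ σ (f a) ∧ ∀ᶠ y in 𝓝 (f a), f (σ y) = y := by
  have := FiniteDimensional.complete ℝ F
  obtain ⟨R, hR⟩ := f'.exists_rightInverse_of_surjective (LinearMap.range_eq_top.2 hsurj)
  have hin : HasStrictFDerivAt (fun v : F ↦ a + R v) R 0 := R.hasStrictFDerivAt.const_add a
  have h : HasStrictFDerivAt (fun v : F ↦ f (a + R v))
      ((ContinuousLinearEquiv.refl ℝ F : F ≃L[ℝ] F) : F →L[ℝ] F) 0 := by
    have hf0 : HasStrictFDerivAt f f' (a + R 0) := by simpa using hf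
    have := hf0.comp (0 : F) hin
    rw [hR] at this
    exact this
  have h1 := h.to_localInverse
  have h2 := h.eventually_right_inverse
  have h3 := h.localInverse_apply_image
  simp only [map_zero, add_zero] at h1 h2 h3
  refine ⟨fun y ↦ a + R (h.localInverse _ _ _ y), by simp [h3], ?_, h2⟩
  exact (R.differentiableAt.comp _ h1.hasFDerivAt.differentiableAt).const_add a

end VectorSpace

/-! ### The Lie derivative on a manifold -/

section LieDerivative

open Filter Topology Set

variable {E : Type*} [NormedAddCommGroup E] [NormedSpace ℝ E]
  {H : Type*} [TopologicalSpace H] {I : ModelWithCorners ℝ E H}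
  {M : Type*} [TopologicalSpace M] [ChartedSpace H M] [IsManifold I ∞ M]

/-- The vector field `V` read in the chart at `x`: the pullback under the inverse chart is the image
under the differential of the chart. -/
theorem mpullbackWithin_extChartAt_symm_apply {x : M} (V : Π x : M, TangentSpace I x)
    {y : E} (hy : y ∈ (extChartAt I x).target) :
    mpullbackWithin 𝓘(ℝ, E) I (extChartAt I x).symm V (range I) y =
      mfderiv I 𝓘(ℝ, E) (extChartAt I x) ((extChartAt I x).symm y)
        (V ((extChartAt I x).symm y)) := by
  have h1 := mfderiv_extChartAt_comp_mfderivWithin_extChartAt_symm (I := I) hy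
  have h2 := mfderivWithin_extChartAt_symm_comp_mfderiv_extChartAt (I := I) hy
  rw [mpullbackWithin_apply, ContinuousLinearMap.inverse_eq h2 h1]
  rfl

/-- The Lie derivative formula on a manifold without boundary, for a `C²` family `b (s, ·)` of
self-maps with `b (0, ·) = id` and initial velocity field `A`: if `T s` is the pullback of the
vector field `V` under `b (s, ·)`, evaluated at the fixed point `x`, then the derivative of `T` at
`0` is `[A, V] x`. The family need not be a flow. -/
theorem hasDerivAt_mpullback_family [I.Boundaryless] [CompleteSpace E]
    {b : ℝ × M → M} {x : M} (hb : ContMDiffAt (𝓘(ℝ, ℝ).prod I) I 2 b (0, x))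
    (h0 : ∀ y, b (0, y) = y) {A V : Π x : M, TangentSpace I x}
    (hV : MDifferentiableAt I I.tangent (fun y ↦ (⟨y, V y⟩ : TangentBundle I M)) x)
    (hA : ∀ y, (A y : E) = mfderiv 𝓘(ℝ, ℝ) I (fun s ↦ b (s, y)) 0 (1 : ℝ))
    {T : ℝ → E}
    (hT : ∀ᶠ s in 𝓝 (0 : ℝ), mfderiv I I (fun y ↦ b (s, y)) x (T s) = V (b (s, x))) :
    HasDerivAt T (mlieBracket I A V x) 0 := by
  set φ := extChartAt I x with hφ
  have hz : φ x ∈ φ.target := mem_extChartAt_target x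
  have hinv : φ.symm (φ x) = x := extChartAt_to_inv x
  have hbx : b (0, x) = x := h0 x
  have htarget : φ.target ∈ 𝓝 (φ x) := extChartAt_target_mem_nhds x
  have hsrc : (chartAt H x).source ∈ 𝓝 x := chart_source_mem_nhds H x
  have : IsManifold I 2 M := inferInstance
  -- differentials of `φ`, seen as maps between fixed spaces
  let dφ : M → E → E := fun q v ↦ mfderiv I 𝓘(ℝ, E) φ q v
  let F : ℝ × E → E := fun q ↦ φ (b (q.1, φ.symm q.2))
  let V' : E → E := fun y ↦ dφ (φ.symm y) (V (φ.symm y))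
  let A' : E → E := fun y ↦ dφ (φ.symm y) (A (φ.symm y))
  have hpull : ∀ W : Π x : M, TangentSpace I x,
      (mpullbackWithin 𝓘(ℝ, E) I φ.symm W (range I) : E → E) =ᶠ[𝓝 (φ x)]
        fun y ↦ dφ (φ.symm y) (W (φ.symm y)) := by
    intro W
    filter_upwards [htarget] with y hy
    exact mpullbackWithin_extChartAt_symm_apply W hy
  -- smoothness of the family in the chart
  have hsymm : ContMDiffAt 𝓘(ℝ, E) I 2 φ.symm (φ x) :=
    (contMDiffOn_extChartAt_symm x).contMDiffAt htarget
  have hbev : ∀ᶠ q in 𝓝 ((0 : ℝ), x), ContMDiffAt (𝓘(ℝ, ℝ).prod I) I 2 b q :=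
    (contMDiffAt_iff_contMDiffAt_nhds (by simp)).1 hb
  have hF : ContDiffAt ℝ 2 F (0, φ x) := by
    have h1 : ContMDiffAt 𝓘(ℝ, ℝ × E) (𝓘(ℝ, ℝ).prod I) 2
        (fun q : ℝ × E ↦ (q.1, φ.symm q.2)) (0, φ x) := by
      refine ContMDiffAt.prodMk contDiff_fst.contDiffAt.contMDiffAt ?_
      exact ContMDiffAt.comp (0, φ x) (g := φ.symm) (f := Prod.snd) hsymm
        contDiff_snd.contDiffAt.contMDiffAt
    have h2 : ContMDiffAt 𝓘(ℝ, ℝ × E) I 2 (fun q : ℝ × E ↦ b (q.1, φ.symm q.2)) (0, φ x) := by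
      refine ContMDiffAt.comp_of_eq (g := b) hb h1 ?_
      simp [hinv]
    have h3 : ContMDiffAt 𝓘(ℝ, ℝ × E) 𝓘(ℝ, E) 2 F (0, φ x) := by
      refine ContMDiffAt.comp_of_eq (g := φ) (contMDiffAt_extChartAt (x := x)) h2 ?_
      simp [hinv, hbx]
    exact h3.contDiffAt
  have hF0 : ∀ᶠ y in 𝓝 (φ x), F (0, y) = y := by
    filter_upwards [htarget] with y hy
    simp only [F, h0]
    exact φ.right_inv hy
  -- the field `V` in the chart
  have hV' : DifferentiableAt ℝ V' (φ x) := by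
    have h1 := MDifferentiableWithinAt.differentiableWithinAt_mpullbackWithin_vectorField
      (s := univ) (by simpa using hV.mdifferentiableWithinAt)
    rw [preimage_univ, univ_inter, I.range_eq_univ] at h1
    replace h1 := differentiableWithinAt_univ.1 h1
    have h2 := hpull V
    rw [I.range_eq_univ] at h2
    exact h2.differentiableAt_iff.1 h1
  -- the derivative of `b (·, y)` in the chart
  have hA' : (fun y ↦ deriv (fun s ↦ F (s, y)) 0) =ᶠ[𝓝 (φ x)] A' := by
    have hc : Tendsto (fun y ↦ ((0 : ℝ), φ.symm y)) (𝓝 (φ x)) (𝓝 (0, x)) := by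
      have := (continuousAt_const (y := (0 : ℝ))).prodMk hsymm.continuousAt
      rw [ContinuousAt, hinv] at this
      exact this
    filter_upwards [htarget, hc.eventually hbev] with y hy hby
    have hysrc : φ.symm y ∈ (chartAt H x).source := by
      have := φ.map_target hy
      rwa [extChartAt_source] at this
    have hby1 : MDifferentiableAt 𝓘(ℝ, ℝ) I (fun s ↦ b (s, φ.symm y)) 0 := by
      have h1 : MDifferentiableAt 𝓘(ℝ, ℝ) (𝓘(ℝ, ℝ).prod I) (fun s : ℝ ↦ (s, φ.symm y)) 0 :=
        mdifferentiableAt_id.prodMk mdifferentiableAt_const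
      exact MDifferentiableAt.comp (0 : ℝ) (g := b) (hby.mdifferentiableAt (by simp)) h1
    have h1 := mfderiv_comp_apply_of_eq (I := 𝓘(ℝ, ℝ)) (I' := I) (I'' := 𝓘(ℝ, E)) (0 : ℝ)
      (g := φ) (y := φ.symm y) (mdifferentiableAt_extChartAt hysrc) hby1 (h0 _) (1 : ℝ)
    rw [mfderiv_eq_fderiv] at h1
    have h2 : (mfderiv 𝓘(ℝ, ℝ) I (fun s ↦ b (s, φ.symm y)) 0 (1 : ℝ) : E) = A (φ.symm y) :=
      (hA _).symm
    exact h1.trans (congrArg (dφ (φ.symm y)) h2)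
  -- the defining property of `T` in the chart
  have hT' : ∀ᶠ s in 𝓝 (0 : ℝ),
      fderiv ℝ (fun y ↦ F (s, y)) (φ x) (dφ x (T s)) = V' (F (s, φ x)) := by
    have hc : Tendsto (fun s : ℝ ↦ (s, x)) (𝓝 0) (𝓝 (0, x)) :=
      (Continuous.prodMk_left x).tendsto 0
    have hcb : Tendsto (fun s : ℝ ↦ b (s, x)) (𝓝 0) (𝓝 x) := by
      have := hb.continuousAt.tendsto.comp hc
      rwa [hbx] at this
    have hFd : ∀ᶠ q in 𝓝 ((0 : ℝ), φ x), DifferentiableAt ℝ F q :=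
      (hF.eventually (by simp)).mono fun q hq ↦ hq.differentiableAt (by simp)
    have hc2 : Tendsto (fun s : ℝ ↦ (s, φ x)) (𝓝 0) (𝓝 (0, φ x)) :=
      (Continuous.prodMk_left (φ x)).tendsto 0
    filter_upwards [hT, hc.eventually hbev, hcb.eventually hsrc, hc2.eventually hFd]
      with s hs1 hs2 hs3 hs4
    have hbs : MDifferentiableAt I I (fun y ↦ b (s, y)) x := by
      have h1 : MDifferentiableAt I (𝓘(ℝ, ℝ).prod I) (fun y : M ↦ (s, y)) x :=
        mdifferentiableAt_const.prodMk mdifferentiableAt_id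
      exact MDifferentiableAt.comp x (g := b) (hs2.mdifferentiableAt (by simp)) h1
    have hFs : DifferentiableAt ℝ (fun y ↦ F (s, y)) (φ x) :=
      DifferentiableAt.comp (φ x) (g := F) hs4
        ((differentiableAt_const s).prodMk differentiableAt_id)
    have e1 := mfderiv_comp_apply (I := I) (I' := I) (I'' := 𝓘(ℝ, E)) x (g := φ)
      (mdifferentiableAt_extChartAt hs3) hbs (T s)
    have e2 := mfderiv_comp_apply (I := I) (I' := 𝓘(ℝ, E)) (I'' := 𝓘(ℝ, E)) x
      (f := φ) (g := fun y ↦ F (s, y)) hFs.mdifferentiableAt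
      (mdifferentiableAt_extChartAt (mem_chart_source H x)) (T s)
    have e3 : (fun y ↦ F (s, y)) ∘ φ =ᶠ[𝓝 x] φ ∘ fun y ↦ b (s, y) := by
      filter_upwards [extChartAt_source_mem_nhds (I := I) x] with y hy
      simp only [Function.comp_apply, F]
      rw [φ.left_inv hy]
    rw [mfderiv_eq_fderiv] at e2
    have e4 : (mfderiv I 𝓘(ℝ, E) ((fun y ↦ F (s, y)) ∘ φ) x (T s) : E) =
        mfderiv I 𝓘(ℝ, E) (φ ∘ fun y ↦ b (s, y)) x (T s) := by
      rw [e3.mfderiv_eq]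
      rfl
    have e5 : φ.symm (F (s, φ x)) = b (s, x) := by
      simp only [F]
      rw [hinv]
      exact φ.left_inv (by rwa [extChartAt_source])
    have e6 : V' (F (s, φ x)) = dφ (b (s, x)) (V (b (s, x))) :=
      congrArg (fun q ↦ dφ q (V q)) e5
    rw [e6]
    exact e2.symm.trans (e4.trans (e1.trans (congrArg (dφ (b (s, x))) hs1)))
  have main := hasDerivAt_pullback_family hF hF0 hV' hT'
  obtain ⟨D', hD⟩ := isInvertible_mfderiv_extChartAt (I := I) (mem_extChartAt_source (I := I) x)
  let D : E ≃L[ℝ] E := D'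
  have hDapp : ∀ v : E, dφ x v = D v := fun v ↦ by
    change mfderiv I 𝓘(ℝ, E) φ x v = D v
    rw [← hD]
    rfl
  have hbr : (mlieBracket I A V x : E) =
      D.symm (lieBracket ℝ (fun y ↦ deriv (fun s ↦ F (s, y)) 0) V' (φ x)) := by
    rw [← mlieBracketWithin_univ, mlieBracketWithin_apply, ← hD, preimage_univ, univ_inter,
      I.range_eq_univ, ContinuousLinearMap.inverse_equiv]
    have hpA := hpull A
    have hpV := hpull V
    rw [I.range_eq_univ] at hpA hpV
    have : lieBracket ℝ (fun y ↦ deriv (fun s ↦ F (s, y)) 0) V' (φ x) = lieBracket ℝ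
        (mpullbackWithin 𝓘(ℝ, E) I φ.symm A univ) (mpullbackWithin 𝓘(ℝ, E) I φ.symm V univ) (φ x) :=
      Filter.EventuallyEq.lieBracket_vectorField_eq (hA'.trans hpA.symm) hpV.symm
    exact congrArg D.symm ((congrFun lieBracketWithin_univ _).trans this.symm)
  have hcomp : HasDerivAt (fun s ↦ D.symm (dφ x (T s)) : ℝ → E) (mlieBracket I A V x) 0 := by
    have h1 := (D.symm : E →L[ℝ] E).hasFDerivAt.comp_hasDerivAt (0 : ℝ) main
    rw [hbr]
    exact h1
  refine hcomp.congr_of_eventuallyEq (Eventually.of_forall fun s ↦ ?_)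
  change T s = D.symm (dφ x (T s))
  rw [hDapp]
  exact (D.symm_apply_apply (T s)).symm

end LieDerivative

namespace CohomogeneityOne

/-! ### Curves and smooth actions -/

section Curves

open Filter Topology Set

variable {E : Type*} [NormedAddCommGroup E] [NormedSpace ℝ E]
  {H : Type*} [TopologicalSpace H] {I : ModelWithCorners ℝ E H}
  {M : Type*} [TopologicalSpace M] [ChartedSpace H M] [IsManifold I ∞ M]

/-- Local parametrization of a manifold without boundary by its model space, normalized so that the
differential at `0` is the identity of `T_x M`. -/
theorem exists_param [I.Boundaryless] (x : M) :
    ∃ f : E → M, f 0 = x ∧ ContMDiffAt 𝓘(ℝ, E) I ∞ f 0 ∧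
      ∀ v : E, (mfderiv 𝓘(ℝ, E) I f 0 v : E) = v := by
  set φ := extChartAt I x with hφ
  have hinv : φ.symm (φ x) = x := extChartAt_to_inv x
  have htarget : φ.target ∈ 𝓝 (φ x) := extChartAt_target_mem_nhds x
  have hsymm : ContMDiffAt 𝓘(ℝ, E) I ∞ φ.symm (φ x) :=
    (contMDiffOn_extChartAt_symm x).contMDiffAt htarget
  let D : E →L[ℝ] E := mfderiv I 𝓘(ℝ, E) φ x
  have hlin : ContDiff ℝ ∞ (fun v : E ↦ φ x + D v) := contDiff_const.add D.contDiff
  have h0 : φ x + D 0 = φ x := by simp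
  refine ⟨fun v ↦ φ.symm (φ x + D v), by simp only [h0, hinv], ?_, fun v ↦ ?_⟩
  · exact ContMDiffAt.comp_of_eq (g := φ.symm) hsymm hlin.contMDiff.contMDiffAt h0
  · have h1 := mfderiv_comp_apply_of_eq (I := 𝓘(ℝ, E)) (I' := 𝓘(ℝ, E)) (I'' := I) (0 : E)
      (g := φ.symm) (f := fun v : E ↦ φ x + D v) (hsymm.mdifferentiableAt (by simp))
      (hlin.contMDiff.contMDiffAt.mdifferentiableAt (by simp)) h0 v
    have h2 : fderiv ℝ (fun v : E ↦ φ x + D v) 0 = D := by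
      rw [fderiv_const_add]
      exact D.fderiv
    rw [mfderiv_eq_fderiv, h2] at h1
    have h3 := mfderivWithin_extChartAt_symm_comp_mfderiv_extChartAt' (I := I)
      (mem_extChartAt_source (I := I) x)
    rw [I.range_eq_univ, mfderivWithin_univ] at h3
    exact h1.trans (congrArg (fun A : E →L[ℝ] E ↦ A v) h3)

/-- Every tangent vector is the initial velocity of a smooth curve. -/
theorem exists_curve [I.Boundaryless] (x : M) (v : E) :
    ∃ c : ℝ → M, c 0 = x ∧ ContMDiffAt 𝓘(ℝ, ℝ) I ∞ c 0 ∧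
      (mfderiv 𝓘(ℝ, ℝ) I c 0 (1 : ℝ) : E) = v := by
  obtain ⟨f, hf0, hf, hfd⟩ := exists_param (I := I) x
  have hlin : ContDiff ℝ ∞ (fun s : ℝ ↦ s • v) := contDiff_id.smul contDiff_const
  have h0 : (0 : ℝ) • v = 0 := zero_smul _ _
  refine ⟨fun s ↦ f (s • v), (congrArg f h0).trans hf0, ?_, ?_⟩
  · exact ContMDiffAt.comp_of_eq (g := f) hf hlin.contMDiff.contMDiffAt h0
  · have h1 := mfderiv_comp_apply_of_eq (I := 𝓘(ℝ, ℝ)) (I' := 𝓘(ℝ, E)) (I'' := I) (0 : ℝ)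
      (g := f) (f := fun s : ℝ ↦ s • v) (hf.mdifferentiableAt (by simp))
      (hlin.contMDiff.contMDiffAt.mdifferentiableAt (by simp)) h0 (1 : ℝ)
    have h2 : fderiv ℝ (fun s : ℝ ↦ s • v) 0 1 = v := by
      have := ((hasDerivAt_id (0 : ℝ)).smul_const v).deriv
      simpa using! this
    rw [mfderiv_eq_fderiv] at h1
    refine h1.trans ?_
    exact (hfd _).trans h2

end Curves

section Action

open Filter Topology Set

variable {EG : Type*} [NormedAddCommGroup EG] [NormedSpace ℝ EG]
  {HG : Type*} [TopologicalSpace HG] {J : ModelWithCorners ℝ EG HG}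
  {G : Type*} [TopologicalSpace G] [ChartedSpace HG G] [Group G]
  {E : Type*} [NormedAddCommGroup E] [NormedSpace ℝ E]
  {H : Type*} [TopologicalSpace H] {I : ModelWithCorners ℝ E H}
  {M : Type*} [TopologicalSpace M] [ChartedSpace H M]
  [MulAction G M] [ContMDiffSMul J I ∞ G M]

variable (J I) in
theorem mdifferentiableAt_smul_left (g : G) (x : M) :
    MDifferentiableAt J I (fun g : G ↦ g • x) g :=
  (ContMDiffAt.smul (I := J) (I' := I) (n := ∞) (f := id) (g := fun _ ↦ x)
    contMDiffAt_id contMDiffAt_const).mdifferentiableAt (by simp)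

variable (I) in
theorem mdifferentiableAt_smul_right (J : ModelWithCorners ℝ EG HG) [ContMDiffSMul J I ∞ G M]
    (g : G) (x : M) :
    MDifferentiableAt I I (fun y : M ↦ g • y) x :=
  (ContMDiffSMul.contMDiff_const_smul (I := J) (I' := I) (n := ∞) g).contMDiffAt.mdifferentiableAt
    (by simp)

/-- The velocity of `s ↦ c s • y` is the value at `y` of the fundamental field of the velocity of
`c`. -/
theorem mfderiv_curve_smul {c : ℝ → G} {X : GroupLieAlgebra J G} (hc0 : c 0 = 1)
    (hc : MDifferentiableAt 𝓘(ℝ, ℝ) J c 0) (hX : (mfderiv 𝓘(ℝ, ℝ) J c 0 (1 : ℝ) : EG) = X) (y : M) :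
    (mfderiv 𝓘(ℝ, ℝ) I (fun s ↦ c s • y) 0 (1 : ℝ) : E) = fundamentalField J I X y := by
  have h1 := mfderiv_comp_apply_of_eq (I := 𝓘(ℝ, ℝ)) (I' := J) (I'' := I) (0 : ℝ)
    (g := fun g : G ↦ g • y) (f := c) (mdifferentiableAt_smul_left J I 1 y) hc hc0 (1 : ℝ)
  refine h1.trans ?_
  exact congrArg (mfderiv J I (fun g : G ↦ g • y) 1 : EG → E) hX

theorem contMDiffAt_curve_smul {c : ℝ → G} (hc : ContMDiffAt 𝓘(ℝ, ℝ) J ∞ c 0) (x : M) :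
    ContMDiffAt (𝓘(ℝ, ℝ).prod I) I 2 (fun q : ℝ × M ↦ c q.1 • q.2) (0, x) := by
  have h1 : ContMDiffAt (𝓘(ℝ, ℝ).prod I) J ∞ (fun q : ℝ × M ↦ c q.1) (0, x) :=
    ContMDiffAt.comp (0, x) (g := c) (f := Prod.fst) hc contMDiffAt_fst
  exact (ContMDiffAt.smul (I := J) (I' := I) (n := ∞) h1 contMDiffAt_snd).of_le
    ENat.LEInfty.out

variable [LieGroup J ∞ G] [IsManifold I ∞ M]

/-- Fundamental vector fields of a smooth action are smooth. -/
theorem contMDiff_fundamentalField (X : GroupLieAlgebra J G) :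
    ContMDiff I I.tangent ∞ (fun x : M ↦ (⟨x, fundamentalField J I X x⟩ : TangentBundle I M)) := by
  -- the field is `x ↦ DP (X, 0)`, where `P : G × M → M` is the action
  let fg : M → TangentBundle J G := fun _ ↦ TotalSpace.mk' EG 1 X
  have sfg : ContMDiff I J.tangent ∞ fg := contMDiff_const
  let fv : M → TangentBundle I M := fun x ↦ TotalSpace.mk' E x 0
  have sfv : ContMDiff I I.tangent ∞ fv := contMDiff_zeroSection _ _
  let F₁ : M → (TangentBundle J G × TangentBundle I M) := fun x ↦ (fg x, fv x)
  have S₁ : ContMDiff I (J.tangent.prod I.tangent) ∞ F₁ := sfg.prodMk sfv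
  let F₂ : (TangentBundle J G × TangentBundle I M) → TangentBundle (J.prod I) (G × M) :=
    (equivTangentBundleProd J G I M).symm
  have S₂ : ContMDiff (J.tangent.prod I.tangent) (J.prod I).tangent ∞ F₂ :=
    contMDiff_equivTangentBundleProd_symm
  let F₃ : TangentBundle (J.prod I) (G × M) → TangentBundle I M :=
    tangentMap (J.prod I) I (fun q : G × M ↦ q.1 • q.2)
  have S₃ : ContMDiff (J.prod I).tangent I.tangent ∞ F₃ :=
    ContMDiff.contMDiff_tangentMap (n := ∞) (m := ∞) contMDiff_smul (by simp)
  have S := (S₃.comp S₂).comp S₁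
  refine S.congr fun x ↦ ?_
  have hd : MDifferentiableAt (J.prod I) I (fun q : G × M ↦ q.1 • q.2) (1, x) :=
    (contMDiff_smul (I := J) (I' := I) (n := ∞)).contMDiffAt.mdifferentiableAt (by simp)
  let X' : EG := X
  have h1 := mfderiv_prod_eq_add_apply hd (v := (X', (0 : E)))
  have h2 : (mfderiv (J.prod I) I (fun q : G × M ↦ q.1 • q.2) (1, x) (X', (0 : E)) : E) =
      fundamentalField J I X x := by
    refine h1.trans ?_
    change (mfderiv J I (fun g : G ↦ g • x) 1 X : E) + mfderiv I I (fun y : M ↦ (1 : G) • y) x 0 = _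
    rw [map_zero]
    exact add_zero _
  have h3 : (1 : G) • x = x := one_smul G x
  refine Bundle.TotalSpace.ext ?_ ?_
  · exact h3.symm
  · exact heq_of_eq h2.symm

theorem mdifferentiableAt_fundamentalField (X : GroupLieAlgebra J G) (x : M) :
    MDifferentiableAt I I.tangent
      (fun x : M ↦ (⟨x, fundamentalField J I X x⟩ : TangentBundle I M)) x :=
  (contMDiff_fundamentalField X).contMDiffAt.mdifferentiableAt (by simp)

end Action

/-! ### Lie derivatives along fundamental vector fields -/

section LieDerivative

open Filter Topology Set

variable {EG : Type*} [NormedAddCommGroup EG] [NormedSpace ℝ EG]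
  {HG : Type*} [TopologicalSpace HG] {J : ModelWithCorners ℝ EG HG}
  {G : Type*} [TopologicalSpace G] [ChartedSpace HG G] [Group G]
  {E : Type*} [NormedAddCommGroup E] [NormedSpace ℝ E]
  {H : Type*} [TopologicalSpace H] {I : ModelWithCorners ℝ E H}
  {M : Type*} [TopologicalSpace M] [ChartedSpace H M]
  [MulAction G M] [ContMDiffSMul J I ∞ G M]

omit [MulAction G M] [ContMDiffSMul J I ∞ G M] in
theorem hasDerivAt_comp_curve {f : M → ℝ} {γ : ℝ → M} {t : ℝ} {x : M} {v : E} (hx : γ t = x)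
    (hf : MDifferentiableAt I 𝓘(ℝ, ℝ) f x) (hγ : MDifferentiableAt 𝓘(ℝ, ℝ) I γ t)
    (hv : (mfderiv 𝓘(ℝ, ℝ) I γ t (1 : ℝ) : E) = v) :
    HasDerivAt (fun s ↦ f (γ s)) (mvfderiv I f x v) t := by
  subst hx hv
  have h1 : MDifferentiableAt 𝓘(ℝ, ℝ) 𝓘(ℝ, ℝ) (f ∘ γ) t := hf.comp t hγ
  have h2 := (mdifferentiableAt_iff_differentiableAt.1 h1).hasFDerivAt.hasDerivAt
  have h3 := mfderiv_comp_apply (I := 𝓘(ℝ, ℝ)) (I' := I) (I'' := 𝓘(ℝ, ℝ)) t hf hγ (1 : ℝ)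
  rw [mfderiv_eq_fderiv] at h3
  exact h2.congr_deriv h3

variable (I) in
theorem mfderiv_smul_inv_smul (J : ModelWithCorners ℝ EG HG) [ContMDiffSMul J I ∞ G M]
    (g : G) (x : M) (v : E) :
    (mfderiv I I (fun y : M ↦ g • y) x
      (mfderiv I I (fun y : M ↦ g⁻¹ • y) (g • x) v : E) : E) = v := by
  have h1 := mfderiv_comp_apply_of_eq (I := I) (I' := I) (I'' := I) (g • x)
    (g := fun y : M ↦ g • y) (f := fun y : M ↦ g⁻¹ • y) (y := x)
    (mdifferentiableAt_smul_right I J g x) (mdifferentiableAt_smul_right I J g⁻¹ (g • x))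
    (inv_smul_smul g x) v
  have h2 : (fun y : M ↦ g • y) ∘ (fun y : M ↦ g⁻¹ • y) = id := by
    ext y
    simp
  rw [h2, mfderiv_id] at h1
  exact h1.symm

variable [IsManifold I ∞ M] [I.Boundaryless] [CompleteSpace E]

/-- The Lie derivative along a fundamental field `X*` is computed by any curve `c` in the group with
`c 0 = 1` and initial velocity `X`. -/
theorem hasDerivAt_of_smul_curve {c : ℝ → G} {X : GroupLieAlgebra J G} (hc0 : c 0 = 1)
    (hc : ContMDiffAt 𝓘(ℝ, ℝ) J ∞ c 0) (hX : (mfderiv 𝓘(ℝ, ℝ) J c 0 (1 : ℝ) : EG) = X)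
    {V : Π x : M, TangentSpace I x} {x : M}
    (hV : MDifferentiableAt I I.tangent (fun y ↦ (⟨y, V y⟩ : TangentBundle I M)) x)
    {T : ℝ → E} (hT : ∀ s, (mfderiv I I (fun y : M ↦ c s • y) x (T s) : E) = V (c s • x)) :
    HasDerivAt T (mlieBracket I (fundamentalField J I X) V x) 0 :=
  hasDerivAt_mpullback_family (b := fun q : ℝ × M ↦ c q.1 • q.2) (contMDiffAt_curve_smul hc x)
    (fun y ↦ by simp [hc0]) hV
    (fun y ↦ (mfderiv_curve_smul hc0 (hc.mdifferentiableAt (by simp)) hX y).symm)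
    (Eventually.of_forall hT)

/-- An equivariant vector field commutes with the fundamental fields: its pullback along
`s ↦ c s • x` is constant. -/
theorem mlieBracket_fundamentalField_of_equivariant [IsManifold J ∞ G] [J.Boundaryless]
    {ξ : Π x : M, TangentSpace I x}
    {x : M} (hξ : MDifferentiableAt I I.tangent (fun y ↦ (⟨y, ξ y⟩ : TangentBundle I M)) x)
    (heq : ∀ (g : G) (x : M), mfderiv I I (fun y : M ↦ g • y) x (ξ x) = ξ (g • x))
    (X : GroupLieAlgebra J G) : mlieBracket I (fundamentalField J I X) ξ x = 0 := by
  obtain ⟨c, hc0, hc, hcX⟩ := exists_curve (I := J) (1 : G) X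
  have h1 := hasDerivAt_of_smul_curve hc0 hc hcX hξ (T := fun _ ↦ ξ x) (fun s ↦ heq (c s) x)
  exact h1.unique (hasDerivAt_const _ _)

/-- Fundamental fields of an isometric action satisfy the Killing equation, in the form
`X* ⟨V, W⟩ = ⟨[X*, V], W⟩ + ⟨V, [X*, W]⟩`. -/
theorem mvfderiv_inner_fundamentalField [IsManifold J ∞ G] [J.Boundaryless]
    [RiemannianBundle (fun x : M ↦ TangentSpace I x)]
    [IsContMDiffRiemannianBundle I ∞ E (fun x : M ↦ TangentSpace I x)]
    (hiso : ∀ (g : G) (x : M) (v w : TangentSpace I x),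
      inner ℝ (mfderiv I I (fun y : M ↦ g • y) x v) (mfderiv I I (fun y : M ↦ g • y) x w)
        = inner ℝ v w)
    {V W : Π x : M, TangentSpace I x} {x : M}
    (hV : MDifferentiableAt I I.tangent (fun y ↦ (⟨y, V y⟩ : TangentBundle I M)) x)
    (hW : MDifferentiableAt I I.tangent (fun y ↦ (⟨y, W y⟩ : TangentBundle I M)) x)
    (X : GroupLieAlgebra J G) :
    mvfderiv I (fun y : M ↦ inner ℝ (V y) (W y)) x (fundamentalField J I X x) =
      inner ℝ (mlieBracket I (fundamentalField J I X) V x) (W x) +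
        inner ℝ (V x) (mlieBracket I (fundamentalField J I X) W x) := by
  obtain ⟨c, hc0, hc, hcX⟩ := exists_curve (I := J) (1 : G) X
  have hcx : c 0 • x = x := by rw [hc0, one_smul]
  -- the pullback to `T_x M` of a vector field along `s ↦ c s • x`
  let T : (Π x : M, TangentSpace I x) → ℝ → E := fun U s ↦
    mfderiv I I (fun y : M ↦ (c s)⁻¹ • y) (c s • x) (U (c s • x))
  have hT : ∀ (U : Π x : M, TangentSpace I x) (s : ℝ),
      (mfderiv I I (fun y : M ↦ c s • y) x (T U s) : E) = U (c s • x) :=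
    fun U s ↦ mfderiv_smul_inv_smul I J (c s) x _
  have hT0 : ∀ U : Π x : M, TangentSpace I x, T U 0 = U x := by
    intro U
    have h1 := hT U 0
    have h2 : (fun y : M ↦ c 0 • y) = id := by
      ext y
      simp [hc0]
    rw [h2, mfderiv_id] at h1
    exact h1.trans (congrArg (fun z ↦ (U z : E)) hcx)
  have hdV := hasDerivAt_of_smul_curve hc0 hc hcX hV (hT V)
  have hdW := hasDerivAt_of_smul_curve hc0 hc hcX hW (hT W)
  let B : E →L[ℝ] E →L[ℝ] ℝ := innerSL ℝ (E := TangentSpace I x)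
  have hB : ∀ v w : TangentSpace I x, B v w = inner ℝ v w := fun v w ↦ rfl
  have hfun : (fun s ↦ (inner ℝ (V (c s • x)) (W (c s • x)) : ℝ)) =
      fun s ↦ B (T V s) (T W s) := by
    ext s
    have h1 := hiso (c s) x (T V s) (T W s)
    have h2 : ∀ v w : E, v = V (c s • x) → w = W (c s • x) →
        (inner ℝ (V (c s • x)) (W (c s • x)) : ℝ) =
          inner ℝ (E := TangentSpace I (c s • x)) v w := by
      rintro _ _ rfl rfl
      rfl
    exact (h2 _ _ (hT V s) (hT W s)).trans h1
  have hd1 : HasDerivAt (fun s ↦ B (T V s) (T W s))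
      (B (T V 0) (mlieBracket I (fundamentalField J I X) W x) +
        B (mlieBracket I (fundamentalField J I X) V x) (T W 0)) 0 :=
    B.hasDerivAt_of_bilinear (fun _ ↦ hdV) (fun _ ↦ hdW)
  rw [← hfun, hT0, hT0] at hd1
  have hf : MDifferentiableAt I 𝓘(ℝ, ℝ) (fun y : M ↦ (inner ℝ (V y) (W y) : ℝ)) x :=
    MDifferentiableAt.inner_bundle (E := fun x : M ↦ TangentSpace I x) hV hW
  have hcd := hc.mdifferentiableAt (by simp)
  have hγ : MDifferentiableAt 𝓘(ℝ, ℝ) I (fun s ↦ c s • x) 0 :=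
    MDifferentiableAt.comp_of_eq (g := fun g : G ↦ g • x) (0 : ℝ)
      (mdifferentiableAt_smul_left J I 1 x) hcd hc0
  have hd2 := hasDerivAt_comp_curve hcx hf hγ (mfderiv_curve_smul hc0 hcd hcX x)
  have := hd2.unique hd1
  rw [this, add_comm]
  rfl

end LieDerivative

/-! ### The bracket of two fundamental vector fields -/

section Bracket

open Filter Topology Set

variable {EG : Type*} [NormedAddCommGroup EG] [NormedSpace ℝ EG]
  {HG : Type*} [TopologicalSpace HG] {J : ModelWithCorners ℝ EG HG}
  {G : Type*} [TopologicalSpace G] [ChartedSpace HG G] [Group G] [LieGroup J ∞ G]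

/-- Inversion acts as `-1` on velocities at the identity. -/
theorem mfderiv_curve_inv {c : ℝ → G} {X : EG} (hc0 : c 0 = 1)
    (hc : ContMDiffAt 𝓘(ℝ, ℝ) J ∞ c 0) (hX : (mfderiv 𝓘(ℝ, ℝ) J c 0 (1 : ℝ) : EG) = X) :
    (mfderiv 𝓘(ℝ, ℝ) J (fun s ↦ (c s)⁻¹) 0 (1 : ℝ) : EG) = -X := by
  have hcd := hc.mdifferentiableAt (by simp)
  have hid := (hc.inv (I := J)).mdifferentiableAt (by simp)
  have hd0 : (c 0)⁻¹ = 1 := by simp [hc0]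
  have hmul : MDifferentiableAt (J.prod J) J (fun q : G × G ↦ q.1 * q.2) (1, 1) :=
    (contMDiff_mul J ∞).contMDiffAt.mdifferentiableAt (by simp)
  have h1 := mfderiv_comp_apply_of_eq (I := 𝓘(ℝ, ℝ)) (I' := J.prod J) (I'' := J) (0 : ℝ)
    (g := fun q : G × G ↦ q.1 * q.2) (f := fun s ↦ (c s, (c s)⁻¹)) (y := (1, 1)) hmul
    (hcd.prodMk hid) (by simp [hc0]) (1 : ℝ)
  have h2 : (fun q : G × G ↦ q.1 * q.2) ∘ (fun s ↦ (c s, (c s)⁻¹)) = fun _ ↦ (1 : G) := by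
    ext s
    simp
  rw [h2, mfderiv_const] at h1
  have h3 : (mfderiv 𝓘(ℝ, ℝ) (J.prod J) (fun s ↦ (c s, (c s)⁻¹)) 0 (1 : ℝ) : EG × EG) =
      (X, (mfderiv 𝓘(ℝ, ℝ) J (fun s ↦ (c s)⁻¹) 0 (1 : ℝ) : EG)) := by
    rw [mfderiv_prodMk hcd hid, ← hX]
    rfl
  let D : EG := mfderiv 𝓘(ℝ, ℝ) J (fun s ↦ (c s)⁻¹) 0 (1 : ℝ)
  have h4 := mfderiv_prod_eq_add_apply hmul (v := (X, D))
  have h5 : (fun z : G ↦ z * 1) = id := by ext; simp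
  have h6 : (fun z : G ↦ 1 * z) = id := by ext; simp
  simp only at h4
  rw [h5, h6, mfderiv_id] at h4
  replace h4 : (mfderiv (J.prod J) J (fun q : G × G ↦ q.1 * q.2) (1, 1) (X, D) : EG) = X + D := h4
  have h7 := h1.trans ((congrArg
    (mfderiv (J.prod J) J (fun q : G × G ↦ q.1 * q.2) (1, 1) : EG × EG → EG) h3).trans h4)
  exact (neg_eq_of_add_eq_zero_right (h7.symm : X + D = 0)).symm

/-- Right translation by `g` maps `Ad g Y` to the value at `g` of the left invariant field `Y`. -/
theorem mfderiv_mul_right_Ad (g : G) (Y : GroupLieAlgebra J G) :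
    (mfderiv J J (fun h : G ↦ h * g) 1 (Ad J g Y) : EG) = mulInvariantVectorField Y g := by
  have hconj : MDifferentiableAt J J (fun h : G ↦ g * h * g⁻¹) 1 :=
    ((contMDiffAt_const.mul contMDiffAt_id).mul contMDiffAt_const :
      ContMDiffAt J J ∞ (fun h : G ↦ g * h * g⁻¹) 1).mdifferentiableAt (by simp)
  have hR : MDifferentiableAt J J (fun h : G ↦ h * g) 1 :=
    (contMDiff_mul_right (I := J) (n := ∞) (a := g)).contMDiffAt.mdifferentiableAt (by simp)
  have h1 := mfderiv_comp_apply_of_eq (I := J) (I' := J) (I'' := J) (1 : G)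
    (g := fun h : G ↦ h * g) (f := fun h : G ↦ g * h * g⁻¹) hR hconj (by simp) Y
  have h2 : (fun h : G ↦ h * g) ∘ (fun h : G ↦ g * h * g⁻¹) = fun h ↦ g * h := by
    ext h
    simp
  rw [h2] at h1
  exact h1.symm

theorem lieGroup_minSmoothness : LieGroup J (minSmoothness ℝ 3) G :=
  LieGroup.of_le (n := ∞) (by
    simp only [minSmoothness_of_isRCLikeNormedField]
    exact ENat.LEInfty.out)

/-- The differential of the adjoint representation is the Lie bracket. -/
theorem hasDerivAt_Ad [J.Boundaryless] [CompleteSpace EG] {c : ℝ → G} {X : GroupLieAlgebra J G}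
    (hc0 : c 0 = 1) (hc : ContMDiffAt 𝓘(ℝ, ℝ) J ∞ c 0)
    (hX : (mfderiv 𝓘(ℝ, ℝ) J c 0 (1 : ℝ) : EG) = X) (Y : GroupLieAlgebra J G) :
    HasDerivAt (F := EG) (fun s ↦ Ad J (c s) Y) (⁅X, Y⁆ : GroupLieAlgebra J G) 0 := by
  have := lieGroup_minSmoothness (J := J) (G := G)
  -- right translations by `c s` have initial velocity the left invariant field of `X`, and the
  -- pullback at `1` of the left invariant field of `Y` is `Ad (c s) Y`
  refine hasDerivAt_mpullback_family (I := J) (b := fun q : ℝ × G ↦ q.2 * c q.1)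
    (A := mulInvariantVectorField X) (V := mulInvariantVectorField Y) (x := (1 : G)) ?_ ?_ ?_ ?_ ?_
  · have h1 : ContMDiffAt (𝓘(ℝ, ℝ).prod J) J ∞ (fun q : ℝ × G ↦ c q.1) (0, 1) :=
      ContMDiffAt.comp (0, (1 : G)) (g := c) (f := Prod.fst) hc contMDiffAt_fst
    exact (contMDiffAt_snd.mul h1).of_le ENat.LEInfty.out
  · intro y
    simp [hc0]
  · exact mdifferentiableAt_mulInvariantVectorField Y
  · intro y
    have hL : MDifferentiableAt J J (fun h : G ↦ y * h) 1 :=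
      (contMDiff_mul_left (I := J) (n := ∞) (a := y)).contMDiffAt.mdifferentiableAt (by simp)
    have h1 := mfderiv_comp_apply_of_eq (I := 𝓘(ℝ, ℝ)) (I' := J) (I'' := J) (0 : ℝ)
      (g := fun h : G ↦ y * h) (f := c) hL (hc.mdifferentiableAt (by simp)) hc0 (1 : ℝ)
    refine Eq.trans ?_ h1.symm
    exact (congrArg (mfderiv J J (fun h : G ↦ y * h) 1 : EG → EG) hX).symm
  · refine Eventually.of_forall fun s ↦ ?_
    refine (mfderiv_mul_right_Ad (c s) Y).trans ?_
    exact congrArg (fun z ↦ (mulInvariantVectorField Y z : EG)) (one_mul (c s)).symm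

variable {E : Type*} [NormedAddCommGroup E] [NormedSpace ℝ E]
  {H : Type*} [TopologicalSpace H] {I : ModelWithCorners ℝ E H}
  {M : Type*} [TopologicalSpace M] [ChartedSpace H M]
  [MulAction G M] [ContMDiffSMul J I ∞ G M]

/-- Translation by `g⁻¹` maps `(Ad g Y)*` to `Y*`. -/
theorem mfderiv_smul_fundamentalField_Ad (g : G) (Y : GroupLieAlgebra J G) (x : M) :
    (mfderiv I I (fun y : M ↦ g⁻¹ • y) x (fundamentalField J I (Ad J g Y) x) : E) =
      fundamentalField J I Y (g⁻¹ • x) := by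
  have hconj : MDifferentiableAt J J (fun h : G ↦ g * h * g⁻¹) 1 :=
    ((contMDiffAt_const.mul contMDiffAt_id).mul contMDiffAt_const :
      ContMDiffAt J J ∞ (fun h : G ↦ g * h * g⁻¹) 1).mdifferentiableAt (by simp)
  have h1 := mfderiv_comp_apply_of_eq (I := J) (I' := J) (I'' := I) (1 : G)
    (g := fun h : G ↦ h • x) (f := fun h : G ↦ g * h * g⁻¹)
    (mdifferentiableAt_smul_left J I 1 x) hconj (by simp) Y
  have hc : MDifferentiableAt J I ((fun h : G ↦ h • x) ∘ fun h : G ↦ g * h * g⁻¹) 1 :=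
    MDifferentiableAt.comp_of_eq (g := fun h : G ↦ h • x) (1 : G)
      (mdifferentiableAt_smul_left J I 1 x) hconj (by simp)
  have h2 := mfderiv_comp_apply_of_eq (I := J) (I' := I) (I'' := I) (1 : G)
    (g := fun y : M ↦ g⁻¹ • y) (f := (fun h : G ↦ h • x) ∘ fun h : G ↦ g * h * g⁻¹) (y := x)
    (mdifferentiableAt_smul_right I J g⁻¹ x) hc (by simp) Y
  have h3 : (fun y : M ↦ g⁻¹ • y) ∘ ((fun h : G ↦ h • x) ∘ fun h : G ↦ g * h * g⁻¹) =
      fun h : G ↦ h • (g⁻¹ • x) := by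
    ext h
    simp [mul_smul]
  rw [h3] at h2
  exact ((h2.trans (congrArg (mfderiv I I (fun y : M ↦ g⁻¹ • y) x : E → E) h1))).symm

/-- `X ↦ X*` is an anti-homomorphism of Lie algebras. -/
theorem mlieBracket_fundamentalField [IsManifold I ∞ M] [I.Boundaryless] [CompleteSpace E]
    [J.Boundaryless] [CompleteSpace EG] (X Y : GroupLieAlgebra J G) (x : M) :
    mlieBracket I (fundamentalField J I X) (fundamentalField J I Y) x =
      -fundamentalField J I ⁅X, Y⁆ x := by
  obtain ⟨c, hc0, hc, hcX⟩ := exists_curve (I := J) (1 : G) X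
  -- the pullback of `Y*` under `(c s)⁻¹` is `(Ad (c s) Y)*`
  let T₀ : ℝ → EG := fun s ↦ Ad J (c s) Y
  let T : ℝ → E := fun s ↦ fundamentalField J I (Ad J (c s) Y) x
  have h1 : HasDerivAt T _ 0 := hasDerivAt_of_smul_curve (c := fun s ↦ (c s)⁻¹) (X := -X)
    (by simp [hc0]) hc.inv (mfderiv_curve_inv hc0 hc hcX) (mdifferentiableAt_fundamentalField Y x)
    (fun s ↦ mfderiv_smul_fundamentalField_Ad (c s) Y x)
  let D : EG →L[ℝ] E := mfderiv J I (fun g : G ↦ g • x) 1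
  have h2 : HasDerivAt T (fundamentalField J I ⁅X, Y⁆ x) 0 :=
    D.hasFDerivAt.comp_hasDerivAt (f := T₀) (0 : ℝ) (hasDerivAt_Ad hc0 hc hcX Y)
  have h3 := h1.unique h2
  have h4 : fundamentalField J I (-X) = (-1 : ℝ) • (fundamentalField J I X : Π x : M, _) := by
    ext y
    change mfderiv J I (fun g : G ↦ g • y) 1 (-X) = (-1 : ℝ) • mfderiv J I (fun g : G ↦ g • y) 1 X
    rw [map_neg]
    simp
  have h5 := mlieBracket_const_smul_left (I := I) (c := (-1 : ℝ))
    (W := fundamentalField J I Y) (mdifferentiableAt_fundamentalField X x)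
  have h6 : (-1 : ℝ) • (mlieBracket I (fundamentalField J I X) (fundamentalField J I Y) x) =
    fundamentalField J I ⁅X, Y⁆ x := h5.symm.trans
      ((congrArg (fun Z ↦ mlieBracket I Z (fundamentalField J I Y) x) h4).symm.trans h3)
  rw [← h6]
  simp

end Bracket

/-! ### Integral curves and the flow of an equivariant field -/

section IntegralCurve

open Filter Topology Set

variable {E : Type*} [NormedAddCommGroup E] [NormedSpace ℝ E]
  {H : Type*} [TopologicalSpace H] {I : ModelWithCorners ℝ E H}
  {M : Type*} [TopologicalSpace M] [ChartedSpace H M]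

theorem mfderiv_integralCurve {ξ : Π x : M, TangentSpace I x} {γ : ℝ → M}
    (hγ : IsMIntegralCurve (I := I) γ ξ) (t : ℝ) :
    (mfderiv 𝓘(ℝ, ℝ) I γ t (1 : ℝ) : E) = ξ (γ t) := by
  rw [(hγ t).mfderiv]
  exact one_smul ℝ (ξ (γ t) : E)

variable [IsManifold I ∞ M]

/-- Integral curves of a continuous vector field are of class `C¹`; in charts, this gives strict
differentiability. -/
theorem hasStrictDerivAt_integralCurve {ξ : Π x : M, TangentSpace I x}
    (hξ : ContMDiff I I.tangent ∞ (fun x ↦ (⟨x, ξ x⟩ : TangentBundle I M))) {γ : ℝ → M}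
    (hγ : IsMIntegralCurve (I := I) γ ξ) (t₀ : ℝ) :
    HasStrictDerivAt (extChartAt I (γ t₀) ∘ γ)
      (mfderiv I 𝓘(ℝ, E) (extChartAt I (γ t₀)) (γ t₀) (ξ (γ t₀)) : E) t₀ := by
  have h1 := (hγ.isMIntegralCurveAt t₀).eventually_hasDerivAt
  have h2 : ContinuousAt
      (fun y ↦ (trivializationAt E (TangentSpace I) (γ t₀) ⟨y, ξ y⟩).2) (γ t₀) :=
    ((contMDiffAt_section (E := fun x : M ↦ TangentSpace I x) (γ t₀)).1
      (hξ (γ t₀))).continuousAt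
  have h3 : ContinuousAt (fun t ↦ tangentCoordChange I (γ t) (γ t₀) (γ t) (ξ (γ t))) t₀ :=
    ContinuousAt.comp (f := γ) h2 hγ.continuous.continuousAt
  have h4 := hasStrictDerivAt_of_hasDerivAt_of_continuousAt h1 h3
  have h5 := mfderiv_comp_apply (I := 𝓘(ℝ, ℝ)) (I' := I) (I'' := 𝓘(ℝ, E)) t₀ (f := γ)
    (mdifferentiableAt_extChartAt (mem_chart_source H (γ t₀))) (hγ t₀).mdifferentiableAt (1 : ℝ)
  rw [mfderiv_eq_fderiv] at h5
  refine h4.congr_deriv (h4.hasDerivAt.deriv.symm.trans (h5.trans ?_))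
  exact congrArg (mfderiv I 𝓘(ℝ, E) (extChartAt I (γ t₀)) (γ t₀) : E → E)
    (mfderiv_integralCurve hγ t₀)

variable [T2Space M] [I.Boundaryless] {ξ : Π x : M, TangentSpace I x} {φ : ℝ → M → M}

/-- The group property of the flow, by uniqueness of integral curves. -/
theorem flow_add (hξ : ContMDiff I I.tangent ∞ (fun x ↦ (⟨x, ξ x⟩ : TangentBundle I M)))
    (hφ : IsGlobalFlow I ξ φ) (s t : ℝ) (x : M) : φ (s + t) x = φ s (φ t x) := by
  have h1 : IsMIntegralCurve (I := I) ((fun r ↦ φ r x) ∘ (· + t)) ξ :=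
    (hφ.integralCurve x).comp_add t
  have h2 := isMIntegralCurve_Ioo_eq_of_contMDiff_boundaryless (t₀ := 0)
    (hξ.of_le ENat.LEInfty.out) h1 (hφ.integralCurve (φ t x)) (by simp [hφ.map_zero])
  exact congrFun h2 s

/-- The flow of an equivariant field commutes with the action: `r ↦ g • φ r x` is an integral curve
as well. -/
theorem flow_smul {EG : Type*} [NormedAddCommGroup EG] [NormedSpace ℝ EG]
    {HG : Type*} [TopologicalSpace HG] (J : ModelWithCorners ℝ EG HG)
    {G : Type*} [TopologicalSpace G] [ChartedSpace HG G] [Group G]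
    [MulAction G M] [ContMDiffSMul J I ∞ G M]
    (hξ : ContMDiff I I.tangent ∞ (fun x ↦ (⟨x, ξ x⟩ : TangentBundle I M)))
    (heq : ∀ (g : G) (x : M), mfderiv I I (fun y : M ↦ g • y) x (ξ x) = ξ (g • x))
    (hφ : IsGlobalFlow I ξ φ) (t : ℝ) (g : G) (x : M) : φ t (g • x) = g • φ t x := by
  have h1 : IsMIntegralCurve (I := I) (fun r ↦ g • φ r x) ξ := by
    intro r
    have h2 := HasMFDerivAt.comp r (mdifferentiableAt_smul_right I J g (φ r x)).hasMFDerivAt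
      (hφ.integralCurve x r)
    refine h2.congr_mfderiv ?_
    rw [← heq]
    ext
    exact (congrArg (mfderiv I I (fun y : M ↦ g • y) (φ r x) : E → E)
      (one_smul ℝ (ξ (φ r x) : E))).trans (one_smul ℝ _).symm
  have h2 := isMIntegralCurve_Ioo_eq_of_contMDiff_boundaryless (t₀ := 0)
    (hξ.of_le ENat.LEInfty.out) (hφ.integralCurve (g • x)) h1 (by simp [hφ.map_zero])
  exact congrFun h2 t

end IntegralCurve

/-! ### Differentiability and invariance properties of the flow -/

/-- A vector outside a hyperplane, given as the range of `L`, spans a complement of it. -/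
theorem exists_smul_add_of_finrank {F E : Type*} [AddCommGroup F] [Module ℝ F] [AddCommGroup E]
    [Module ℝ E] [FiniteDimensional ℝ E] {L : F →ₗ[ℝ] E} {w : E}
    (hw : w ∉ L.range) (hrank : Module.finrank ℝ L.range + 1 = Module.finrank ℝ E) (v : E) :
    ∃ (s : ℝ) (u : F), s • w + L u = v := by
  have hlt : L.range < L.range ⊔ Submodule.span ℝ {w} := by
    refine lt_of_le_of_ne le_sup_left fun h ↦ hw ?_
    rw [h]
    exact Submodule.mem_sup_right (Submodule.mem_span_singleton_self w)
  have htop : L.range ⊔ Submodule.span ℝ {w} = ⊤ := by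
    apply Submodule.eq_top_of_finrank_eq
    have h1 := Submodule.finrank_lt_finrank_of_lt hlt
    have h2 := Submodule.finrank_le (L.range ⊔ Submodule.span ℝ {w})
    omega
  have hv : v ∈ L.range ⊔ Submodule.span ℝ {w} := by rw [htop]; trivial
  obtain ⟨y, ⟨u, rfl⟩, z, hz, rfl⟩ := Submodule.mem_sup.1 hv
  obtain ⟨s, rfl⟩ := Submodule.mem_span_singleton.1 hz
  exact ⟨s, u, add_comm _ _⟩

section Flow

open Filter Topology Set

variable {EG : Type*} [NormedAddCommGroup EG] [NormedSpace ℝ EG]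
  {HG : Type*} [TopologicalSpace HG] {J : ModelWithCorners ℝ EG HG}
  {G : Type*} [TopologicalSpace G] [ChartedSpace HG G] [Group G]
  {E : Type*} [NormedAddCommGroup E] [NormedSpace ℝ E] [FiniteDimensional ℝ E]
  {H : Type*} [TopologicalSpace H] {I : ModelWithCorners ℝ E H} [I.Boundaryless]
  {M : Type*} [TopologicalSpace M] [ChartedSpace H M] [IsManifold I ∞ M]
  [MulAction G M] [ContMDiffSMul J I ∞ G M]

/-- If `ξ x` and the tangent space of the orbit of `x` span `T_x M`, then every point near `x` is of
the form `g • γ s`, where `γ` is the integral curve of `ξ` through `x`, with `s` and (a coordinate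
of) `g` depending differentiably on the point. -/
theorem exists_orbit_coordinates {ξ : Π x : M, TangentSpace I x}
    (hξ : ContMDiff I I.tangent ∞ (fun x ↦ (⟨x, ξ x⟩ : TangentBundle I M))) {γ : ℝ → M} {x : M}
    (hγ : IsMIntegralCurve (I := I) γ ξ) (hx : γ 0 = x)
    (hsurj : ∀ v : E, ∃ (s : ℝ) (X : EG),
      s • (ξ x : E) + (fundamentalField (G := G) J I X x : E) = v)
    {f : EG → G} (hf0 : f 0 = 1) (hf : ContMDiffAt 𝓘(ℝ, EG) J ∞ f 0)
    (hfd : ∀ v : EG, (mfderiv 𝓘(ℝ, EG) J f 0 v : EG) = v) :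
    ∃ σ : M → ℝ × EG, σ x = 0 ∧ MDifferentiableAt I 𝓘(ℝ, ℝ × EG) σ x ∧
      ∀ᶠ y in 𝓝 x, f (σ y).2 • γ (σ y).1 = y := by
  subst hx
  set x := γ 0 with hx
  set χ := extChartAt I x with hχ
  have hinv : χ.symm (χ x) = x := extChartAt_to_inv x
  have htarget : χ.target ∈ 𝓝 (χ x) := extChartAt_target_mem_nhds x
  have hsymm : ContMDiffAt 𝓘(ℝ, E) I ∞ χ.symm (χ x) :=
    (contMDiffOn_extChartAt_symm x).contMDiffAt htarget
  have hf0x : f 0 • x = x := by rw [hf0, one_smul]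
  let D : E →L[ℝ] E := mfderiv I 𝓘(ℝ, E) χ x
  -- the action in charts
  let k : E × EG → E := fun q ↦ χ (f q.2 • χ.symm q.1)
  have hk : ContDiffAt ℝ ∞ k (χ x, 0) := by
    have h1 : ContMDiffAt 𝓘(ℝ, E × EG) J ∞ (fun q : E × EG ↦ f q.2) (χ x, 0) :=
      ContMDiffAt.comp (χ x, (0 : EG)) (g := f) (f := Prod.snd) hf
        contDiff_snd.contDiffAt.contMDiffAt
    have h2 : ContMDiffAt 𝓘(ℝ, E × EG) I ∞ (fun q : E × EG ↦ χ.symm q.1) (χ x, 0) :=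
      ContMDiffAt.comp (χ x, (0 : EG)) (g := χ.symm) (f := Prod.fst) hsymm
        contDiff_fst.contDiffAt.contMDiffAt
    have h3 := ContMDiffAt.smul (I := J) (I' := I) (n := ∞) h1 h2
    have h4 : ContMDiffAt 𝓘(ℝ, E × EG) 𝓘(ℝ, E) ∞ k (χ x, 0) := by
      refine ContMDiffAt.comp_of_eq (g := χ) (contMDiffAt_extChartAt (x := x)) h3 ?_
      simp [hinv, hf0]
    exact h4.contDiffAt
  have hγs : HasStrictDerivAt (χ ∘ γ) (D (ξ x)) 0 := hasStrictDerivAt_integralCurve hξ hγ 0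
  -- the map `(s, u) ↦ f u • γ s`, in the chart at `x`
  let h : ℝ × EG → E := fun q ↦ χ (f q.2 • γ q.1)
  have hks := hk.hasStrictFDerivAt (by simp)
  have hpair : HasStrictFDerivAt (fun q : ℝ × EG ↦ ((χ ∘ γ) q.1, q.2))
      (((ContinuousLinearMap.toSpanSingleton ℝ (D (ξ x))).comp
        (ContinuousLinearMap.fst ℝ ℝ EG)).prod (ContinuousLinearMap.snd ℝ ℝ EG)) (0, 0) :=
    (HasStrictFDerivAt.comp (𝕜 := ℝ) ((0 : ℝ), (0 : EG)) (g := χ ∘ γ) (f := Prod.fst)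
      hγs.hasStrictFDerivAt hasStrictFDerivAt_fst).prodMk hasStrictFDerivAt_snd
  have hcomp := HasStrictFDerivAt.comp (𝕜 := ℝ) ((0 : ℝ), (0 : EG)) (g := k)
    (f := fun q : ℝ × EG ↦ ((χ ∘ γ) q.1, q.2)) hks hpair
  have hev : k ∘ (fun q : ℝ × EG ↦ ((χ ∘ γ) q.1, q.2)) =ᶠ[𝓝 ((0 : ℝ), (0 : EG))] h := by
    have h1 : ∀ᶠ s in 𝓝 (0 : ℝ), γ s ∈ χ.source :=
      hγ.continuous.continuousAt.eventually (extChartAt_source_mem_nhds (I := I) x)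
    have h2 : ∀ᶠ q in 𝓝 ((0 : ℝ), (0 : EG)), γ q.1 ∈ χ.source :=
      (continuous_fst.tendsto ((0 : ℝ), (0 : EG))).eventually h1
    filter_upwards [h2] with q hq
    simp only [Function.comp_apply, k, h]
    rw [χ.left_inv hq]
  have hstrict := hcomp.congr_of_eventuallyEq hev
  set h' := (fderiv ℝ k ((χ ∘ γ) ((0 : ℝ), (0 : EG)).1, ((0 : ℝ), (0 : EG)).2)).comp
    (((ContinuousLinearMap.toSpanSingleton ℝ (D (ξ x))).comp (ContinuousLinearMap.fst ℝ ℝ EG)).prod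
        (ContinuousLinearMap.snd ℝ ℝ EG)) with hh'
  -- the two partial derivatives
  have hp1 : ∀ s : ℝ, h' (s, 0) = s • D (ξ x) := by
    have h1 : HasDerivAt (fun s : ℝ ↦ h (s, 0)) (h' (1, 0)) 0 :=
      HasFDerivAt.comp_hasDerivAt (x := (0 : ℝ)) (f := fun s : ℝ ↦ (s, (0 : EG)))
        hstrict.hasFDerivAt ((hasDerivAt_id (0 : ℝ)).prodMk (hasDerivAt_const _ _))
    have h2 : (fun s : ℝ ↦ h (s, 0)) = χ ∘ γ := by
      ext s
      simp [h, hf0]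
    rw [h2] at h1
    have h3 := h1.unique hγs.hasDerivAt
    intro s
    rw [← h3, ← map_smul]
    simp
  have hp2 : ∀ u : EG, h' (0, u) = D (fundamentalField (G := G) J I u x) := by
    intro u
    have h1 : HasFDerivAt (fun u : EG ↦ h (0, u)) (h' ∘L ContinuousLinearMap.inr ℝ ℝ EG) 0 :=
      HasFDerivAt.comp (0 : EG) (f := fun u : EG ↦ ((0 : ℝ), u)) hstrict.hasFDerivAt
        (hasFDerivAt_prodMk_right (0 : ℝ) (0 : EG))
    have horb : MDifferentiableAt 𝓘(ℝ, EG) I ((fun g : G ↦ g • x) ∘ f) 0 :=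
      MDifferentiableAt.comp_of_eq (0 : EG) (mdifferentiableAt_smul_left J I 1 x)
        (hf.mdifferentiableAt (by simp)) hf0
    have h2 := mfderiv_comp_apply_of_eq (I := 𝓘(ℝ, EG)) (I' := I) (I'' := 𝓘(ℝ, E)) (0 : EG)
      (g := χ) (f := (fun g : G ↦ g • x) ∘ f) (y := x)
      (mdifferentiableAt_extChartAt (mem_chart_source H x)) horb hf0x u
    have h3 := mfderiv_comp_apply_of_eq (I := 𝓘(ℝ, EG)) (I' := J) (I'' := I) (0 : EG)
      (g := fun g : G ↦ g • x) (f := f) (mdifferentiableAt_smul_left J I 1 x)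
      (hf.mdifferentiableAt (by simp)) hf0 u
    have h4 : χ ∘ ((fun g : G ↦ g • x) ∘ f) = fun u ↦ h (0, u) := rfl
    rw [h4, mfderiv_eq_fderiv, h1.fderiv] at h2
    refine h2.trans (congrArg D (h3.trans ?_))
    exact congrArg (mfderiv J I (fun g : G ↦ g • x) 1 : EG → E) (hfd u)
  have hsurj' : Function.Surjective h' := by
    intro w
    obtain ⟨D', hD⟩ := isInvertible_mfderiv_extChartAt (I := I) (mem_extChartAt_source (I := I) x)
    let D'' : E ≃L[ℝ] E := D'
    have hDapp : ∀ v : E, D v = D'' v := fun v ↦ by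
      change mfderiv I 𝓘(ℝ, E) χ x v = D' v
      rw [← hD]
      rfl
    obtain ⟨s, X, hv⟩ := hsurj (D''.symm w)
    refine ⟨(s, X), ?_⟩
    have h1 : h' (s, X) = h' (s, 0) + h' (0, X) := by
      rw [← map_add]
      simp
    have h2 : s • D (ξ x) + D (fundamentalField (G := G) J I X x) = w := by
      have h3 : D (s • (ξ x : E) + (fundamentalField (G := G) J I X x : E)) = w :=
        (congrArg D hv).trans ((hDapp _).trans (D''.apply_symm_apply w))
      have h4 : ∀ a b : E, D (s • a + b) = s • D a + D b := fun a b ↦ by rw [map_add, map_smul]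
      exact (h4 _ _).symm.trans h3
    rw [h1, hp1, hp2]
    exact h2
  obtain ⟨σ, hσ0, hσd, hσ⟩ := hstrict.exists_section hsurj'
  have hh0 : h (0, 0) = χ x := by simp only [h, ← hx, hf0x]
  rw [hh0] at hσ0 hσd hσ
  have hχd : MDifferentiableAt I 𝓘(ℝ, E) χ x := mdifferentiableAt_extChartAt (mem_chart_source H x)
  have hσm : MDifferentiableAt I 𝓘(ℝ, ℝ × EG) (fun y ↦ σ (χ y)) x := hσd.comp_mdifferentiableAt hχd
  refine ⟨fun y ↦ σ (χ y), hσ0, hσm, ?_⟩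
  have hcont : ContinuousAt (fun y ↦ f (σ (χ y)).2 • γ (σ (χ y)).1) x := by
    have : ContinuousSMul G M := ContMDiffSMul.continuousSMul (I := J) (I' := I) ∞
    have h1 : ContinuousAt (fun y ↦ (σ (χ y)).2) x := hσm.continuousAt.snd
    have h2 : ContinuousAt (fun y ↦ (σ (χ y)).1) x := hσm.continuousAt.fst
    have h3 : ContinuousAt (fun y ↦ f (σ (χ y)).2) x :=
      ContinuousAt.comp_of_eq (g := f) hf.continuousAt h1 (by rw [hσ0])
    exact h3.smul (hγ.continuous.continuousAt.comp h2)
  have hsrc : χ.source ∈ 𝓝 (f (σ (χ x)).2 • γ (σ (χ x)).1) := by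
    rw [hσ0]
    change χ.source ∈ 𝓝 (f 0 • x)
    rw [hf0x]
    exact extChartAt_source_mem_nhds x
  filter_upwards [hcont.eventually hsrc, hχd.continuousAt.eventually hσ,
    extChartAt_source_mem_nhds (I := I) x] with y h1 h2 h3
  exact χ.injOn h1 h3 h2

end Flow

section FlowDifferential

open Filter Topology Set

variable {EG : Type*} [NormedAddCommGroup EG] [NormedSpace ℝ EG]
  {HG : Type*} [TopologicalSpace HG] {J : ModelWithCorners ℝ EG HG} [J.Boundaryless]
  {G : Type*} [TopologicalSpace G] [ChartedSpace HG G] [Group G] [LieGroup J ∞ G]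
  {E : Type*} [NormedAddCommGroup E] [NormedSpace ℝ E] [FiniteDimensional ℝ E]
  {H : Type*} [TopologicalSpace H] {I : ModelWithCorners ℝ E H} [I.Boundaryless]
  {M : Type*} [TopologicalSpace M] [T2Space M] [ChartedSpace H M] [IsManifold I ∞ M]
  [RiemannianBundle (fun x : M ↦ TangentSpace I x)]
  [MulAction G M] [ContMDiffSMul J I ∞ G M]
  {ξ : Π x : M, TangentSpace I x} {φ : ℝ → M → M}

/-- The flow of the unit normal field is differentiable: near a point `x`, it is
`g • φ s x ↦ g • φ (t + s) x`. -/
theorem mdifferentiableAt_flow (hG : IsRegularCohomogeneityOne J G I M)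
    (hξ : IsUnitNormalField J G I ξ) (hφ : IsGlobalFlow I ξ φ) (t : ℝ) (x : M) :
    MDifferentiableAt I I (φ t) x := by
  obtain ⟨f, hf0, hf, hfd⟩ := exists_param (I := J) (1 : G)
  let L : EG →L[ℝ] E := mfderiv J I (fun g : G ↦ g • x) 1
  have hw : (ξ x : E) ∉ L.toLinearMap.range := by
    rintro ⟨X, hX⟩
    have h1 := hξ.normal X x
    have h2 : fundamentalField J I X x = ξ x := hX
    rw [h2, hξ.unit x] at h1
    exact one_ne_zero h1
  obtain ⟨σ, hσ0, hσd, hσ⟩ := exists_orbit_coordinates hξ.smooth (γ := fun s ↦ φ s x)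
    (hφ.integralCurve x) (hφ.map_zero x)
    (fun v ↦ exists_smul_add_of_finrank (L := L.toLinearMap) hw (hG.codim_one x) v) hf0 hf hfd
  have hev : φ t =ᶠ[𝓝 x] fun y ↦ f (σ y).2 • φ (t + (σ y).1) x := by
    filter_upwards [hσ] with y hy
    rw [flow_add hξ.smooth hφ, ← flow_smul J hξ.smooth hξ.equivariant hφ, hy]
  refine MDifferentiableAt.congr_of_eventuallyEq ?_ hev
  have h1 : MDifferentiableAt I J (fun y ↦ f (σ y).2) x :=
    MDifferentiableAt.comp_of_eq x (g := f) (f := fun y ↦ (σ y).2)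
      (hf.mdifferentiableAt (by simp))
      (differentiableAt_snd.comp_mdifferentiableAt (g := Prod.snd) hσd) (by rw [hσ0]; rfl)
  have h2 : MDifferentiableAt I I (fun y ↦ φ (t + (σ y).1) x) x :=
    MDifferentiableAt.comp x (g := fun s ↦ φ s x) (f := fun y ↦ t + (σ y).1)
      (hφ.integralCurve x _).mdifferentiableAt
      (DifferentiableAt.comp_mdifferentiableAt (g := fun q : ℝ × EG ↦ t + q.1)
        (differentiableAt_fst.const_add t) hσd)
  have h3 : MDifferentiableAt (J.prod I) I (fun q : G × M ↦ q.1 • q.2)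
      (f (σ x).2, φ (t + (σ x).1) x) :=
    (ContMDiffSMul.contMDiff_smul (I := J) (I' := I) (n := ∞)).mdifferentiableAt (by simp)
  exact h3.comp x (f := fun y ↦ (f (σ y).2, φ (t + (σ y).1) x)) (h1.prodMk h2)

theorem mfderiv_flow_fundamentalField (hG : IsRegularCohomogeneityOne J G I M)
    (hξ : IsUnitNormalField J G I ξ) (hφ : IsGlobalFlow I ξ φ) (X : GroupLieAlgebra J G)
    (t : ℝ) (x : M) :
    mfderiv I I (φ t) x (fundamentalField J I X x) = fundamentalField J I X (φ t x) := by
  have h1 := mfderiv_comp_apply_of_eq (I := J) (I' := I) (I'' := I) (1 : G)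
    (g := φ t) (f := fun g : G ↦ g • x) (y := x) (mdifferentiableAt_flow hG hξ hφ t x)
    (mdifferentiableAt_smul_left J I 1 x) (one_smul G x) X
  have h2 : φ t ∘ (fun g : G ↦ g • x) = fun g : G ↦ g • φ t x := by
    ext g
    exact flow_smul J hξ.smooth hξ.equivariant hφ t g x
  rw [h2] at h1
  exact h1.symm

theorem mfderiv_flow_self (hG : IsRegularCohomogeneityOne J G I M)
    (hξ : IsUnitNormalField J G I ξ) (hφ : IsGlobalFlow I ξ φ) (t : ℝ) (x : M) :
    mfderiv I I (φ t) x (ξ x) = ξ (φ t x) := by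
  have h1 := mfderiv_comp_apply_of_eq (I := 𝓘(ℝ, ℝ)) (I' := I) (I'' := I) (0 : ℝ)
    (g := φ t) (f := fun s ↦ φ s x) (y := x) (mdifferentiableAt_flow hG hξ hφ t x)
    (hφ.integralCurve x 0).mdifferentiableAt (hφ.map_zero x) (1 : ℝ)
  have h2 : φ t ∘ (fun s ↦ φ s x) = (fun s ↦ φ s x) ∘ (· + t) := by
    ext s
    simp only [Function.comp_apply]
    rw [← flow_add hξ.smooth hφ, add_comm]
  have h3 : IsMIntegralCurve (I := I) ((fun s ↦ φ s x) ∘ (· + t)) ξ :=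
    (hφ.integralCurve x).comp_add t
  have h4 := mfderiv_integralCurve h3 0
  have h5 := mfderiv_integralCurve (hφ.integralCurve x) 0
  rw [h2] at h1
  have h6 : (ξ (φ 0 x) : E) = ξ x := congrArg (fun y ↦ (ξ y : E)) (hφ.map_zero x)
  have h7 : (ξ (φ (0 + t) x) : E) = ξ (φ t x) := congrArg (fun s ↦ (ξ (φ s x) : E)) (zero_add t)
  have h8 := congrArg (mfderiv I I (φ t) x : E → E) (h5.trans h6)
  exact h8.symm.trans (h1.symm.trans (h4.trans h7))

theorem mfderiv_flow_neg (hG : IsRegularCohomogeneityOne J G I M)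
    (hξ : IsUnitNormalField J G I ξ) (hφ : IsGlobalFlow I ξ φ) (t : ℝ) (x : M) (v : E) :
    (mfderiv I I (φ (-t)) (φ t x) (mfderiv I I (φ t) x v : E) : E) = v := by
  have h1 := mfderiv_comp_apply (I := I) (I' := I) (I'' := I) x
    (g := φ (-t)) (f := φ t) (mdifferentiableAt_flow hG hξ hφ (-t) _)
    (mdifferentiableAt_flow hG hξ hφ t x) v
  have h2 : φ (-t) ∘ φ t = id := by
    ext y
    simp only [Function.comp_apply]
    rw [← flow_add hξ.smooth hφ, neg_add_cancel, hφ.map_zero]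
    rfl
  rw [h2, mfderiv_id] at h1
  exact h1.symm

theorem isInvertible_mfderiv_flow (hG : IsRegularCohomogeneityOne J G I M)
    (hξ : IsUnitNormalField J G I ξ) (hφ : IsGlobalFlow I ξ φ) (t : ℝ) (x : M) :
    (mfderiv I I (φ t) x).IsInvertible := by
  let A : E →L[ℝ] E := mfderiv I I (φ t) x
  let B : E →L[ℝ] E := mfderiv I I (φ (-t)) (φ t x)
  have hBA : ∀ v, B (A v) = v := mfderiv_flow_neg hG hξ hφ t x
  have hinj : Function.Injective A.toLinearMap := Function.LeftInverse.injective hBA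
  have hAB : ∀ v, A (B v) = v := fun v ↦ by
    obtain ⟨w, rfl⟩ := LinearMap.injective_iff_surjective.1 hinj v
    exact congrArg A (hBA w)
  exact ⟨ContinuousLinearEquiv.equivOfInverse A B hBA hAB, rfl⟩

/-- A vector field preserved by the flow equals its own pullback. -/
theorem mpullback_flow (hG : IsRegularCohomogeneityOne J G I M)
    (hξ : IsUnitNormalField J G I ξ) (hφ : IsGlobalFlow I ξ φ) {t : ℝ}
    {V : Π x : M, TangentSpace I x} (hV : ∀ x, mfderiv I I (φ t) x (V x) = V (φ t x)) :
    mpullback I I (φ t) V = V := by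
  ext x
  rw [mpullback_apply, ← hV x]
  exact (isInvertible_mfderiv_flow hG hξ hφ t x).inverse_apply_self (V x)

end FlowDifferential

/-! ### Koszul's formula on action fields -/

section Koszul

variable {E : Type*} [NormedAddCommGroup E] [NormedSpace ℝ E] [FiniteDimensional ℝ E]
  {H : Type*} [TopologicalSpace H] {I : ModelWithCorners ℝ E H}
  {M : Type*} [TopologicalSpace M] [ChartedSpace H M] [IsManifold I ∞ M]
  [RiemannianBundle (fun x : M ↦ TangentSpace I x)]

/-- Koszul's formula. -/
theorem IsLeviCivita.koszul {LC : CovariantDerivative I E (TangentSpace I : M → Type _)}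
    (hLC : IsLeviCivita I LC) {U V W : Π x : M, TangentSpace I x} {x : M}
    (hU : MDifferentiableAt I I.tangent (fun y ↦ (⟨y, U y⟩ : TangentBundle I M)) x)
    (hV : MDifferentiableAt I I.tangent (fun y ↦ (⟨y, V y⟩ : TangentBundle I M)) x)
    (hW : MDifferentiableAt I I.tangent (fun y ↦ (⟨y, W y⟩ : TangentBundle I M)) x) :
    2 * inner ℝ (LC V x (U x)) (W x) =
      mvfderiv I (fun y : M ↦ inner ℝ (V y) (W y)) x (U x)
        + mvfderiv I (fun y : M ↦ inner ℝ (U y) (W y)) x (V x)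
        - mvfderiv I (fun y : M ↦ inner ℝ (U y) (V y)) x (W x)
        + inner ℝ (mlieBracket I U V x) (W x) - inner ℝ (mlieBracket I U W x) (V x)
        - inner ℝ (mlieBracket I V W x) (U x) := by
  have htor : ∀ {A B : Π x : M, TangentSpace I x},
      MDifferentiableAt I I.tangent (fun y ↦ (⟨y, A y⟩ : TangentBundle I M)) x →
      MDifferentiableAt I I.tangent (fun y ↦ (⟨y, B y⟩ : TangentBundle I M)) x →
      mlieBracket I A B x = LC B x (A x) - LC A x (B x) := by
    intro A B hA hB
    have h1 := LC.torsion_apply hA hB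
    rw [hLC.torsion_free] at h1
    exact (sub_eq_zero.1 h1.symm).symm
  rw [hLC.metric V W x (U x) hV hW, hLC.metric U W x (V x) hU hW, hLC.metric U V x (W x) hU hV,
    htor hU hV, htor hU hW, htor hV hW]
  simp only [inner_sub_left]
  rw [real_inner_comm (V x) (LC U x (W x)), real_inner_comm (U x) (LC V x (W x)),
    real_inner_comm (V x) (LC W x (U x)), real_inner_comm (U x) (LC W x (V x))]
  ring

end Koszul

section ActionField

variable {EG : Type*} [NormedAddCommGroup EG] [NormedSpace ℝ EG]
  {HG : Type*} [TopologicalSpace HG] {J : ModelWithCorners ℝ EG HG}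
  {G : Type*} [TopologicalSpace G] [ChartedSpace HG G] [Group G]
  {E : Type*} [NormedAddCommGroup E] [NormedSpace ℝ E]
  {H : Type*} [TopologicalSpace H] {I : ModelWithCorners ℝ E H}
  {M : Type*} [TopologicalSpace M] [ChartedSpace H M] [IsManifold I ∞ M]
  [RiemannianBundle (fun x : M ↦ TangentSpace I x)]
  [MulAction G M] {ξ : Π x : M, TangentSpace I x}

theorem IsUnitNormalField.mdifferentiableAt (hξ : IsUnitNormalField J G I ξ) (x : M) :
    MDifferentiableAt I I.tangent (fun y ↦ (⟨y, ξ y⟩ : TangentBundle I M)) x :=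
  (hξ.smooth x).mdifferentiableAt (by simp)

/-- Only the tangential part contributes, as `ξ` is normal to the orbits. -/
theorem inner_actionField (hξ : IsUnitNormalField J G I ξ) (a : ℝ) (X Y : GroupLieAlgebra J G)
    (x : M) : (inner ℝ (fundamentalField J I X x) (actionField J I ξ a Y x) : ℝ) =
      inner ℝ (fundamentalField J I X x) (fundamentalField J I Y x) := by
  rw [actionField, inner_add_right, real_inner_smul_right, hξ.normal, mul_zero, zero_add]

theorem inner_actionField_actionField (hξ : IsUnitNormalField J G I ξ) (a b : ℝ)
    (X Y : GroupLieAlgebra J G) (x : M) :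
    (inner ℝ (actionField J I ξ a X x) (actionField J I ξ b Y x) : ℝ) =
      a * b + inner ℝ (fundamentalField J I X x) (fundamentalField J I Y x) := by
  rw [actionField, inner_add_left, real_inner_smul_left, inner_actionField hξ, actionField,
    inner_add_right, real_inner_smul_right, hξ.unit, real_inner_comm (fundamentalField J I Y x),
    hξ.normal]
  ring

variable [LieGroup J ∞ G] [ContMDiffSMul J I ∞ G M]

theorem mdifferentiableAt_actionField (hξ : IsUnitNormalField J G I ξ) (a : ℝ)
    (X : GroupLieAlgebra J G) (x : M) :
    MDifferentiableAt I I.tangent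
      (fun y ↦ (⟨y, actionField J I ξ a X y⟩ : TangentBundle I M)) x :=
  mdifferentiableAt_add_section (hξ.mdifferentiableAt x).smul_const_section
    (mdifferentiableAt_fundamentalField X x)

variable [FiniteDimensional ℝ EG] [FiniteDimensional ℝ E] [J.Boundaryless] [I.Boundaryless]

/-- `ξ` corresponds to a central element of the Lie algebra of `A × G`, so only the bracket of the
fundamental fields contributes. -/
theorem mlieBracket_actionField (hξ : IsUnitNormalField J G I ξ) (a b : ℝ)
    (X Y : GroupLieAlgebra J G) (x : M) :
    mlieBracket I (actionField J I ξ a X) (actionField J I ξ b Y) x =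
      -fundamentalField J I ⁅X, Y⁆ x := by
  have : CompleteSpace E := FiniteDimensional.complete ℝ E
  have : CompleteSpace EG := FiniteDimensional.complete ℝ EG
  have hd := hξ.mdifferentiableAt x
  have h0 : ∀ X : GroupLieAlgebra J G, mlieBracket I (fundamentalField J I X) ξ x = 0 :=
    mlieBracket_fundamentalField_of_equivariant hd hξ.equivariant
  have h1 : mlieBracket I ξ (fundamentalField J I Y) x = 0 := by
    rw [mlieBracket_swap_apply, h0, neg_zero]
  change mlieBracket I (a • ξ + fundamentalField J I X) (b • ξ + fundamentalField J I Y) x = _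
  rw [mlieBracket_add_left hd.smul_const_section (mdifferentiableAt_fundamentalField X x),
    mlieBracket_add_right hd.smul_const_section (mdifferentiableAt_fundamentalField Y x),
    mlieBracket_add_right hd.smul_const_section (mdifferentiableAt_fundamentalField Y x),
    mlieBracket_const_smul_left hd, mlieBracket_const_smul_left hd,
    mlieBracket_const_smul_right hd, mlieBracket_const_smul_right hd, h0, h1, mlieBracket_self,
    mlieBracket_fundamentalField X Y x]
  simp

variable [IsContMDiffRiemannianBundle I ∞ E (fun x : M ↦ TangentSpace I x)]

omit [FiniteDimensional ℝ EG] [FiniteDimensional ℝ E] [J.Boundaryless] [I.Boundaryless] in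
theorem mdifferentiableAt_inner_fundamentalField (Y Z : GroupLieAlgebra J G) (x : M) :
    MDifferentiableAt I 𝓘(ℝ, ℝ)
      (fun y : M ↦ (inner ℝ (fundamentalField J I Y y) (fundamentalField J I Z y) : ℝ)) x :=
  MDifferentiableAt.inner_bundle (E := fun x : M ↦ TangentSpace I x)
    (mdifferentiableAt_fundamentalField Y x) (mdifferentiableAt_fundamentalField Z x)

/-- The derivative of `⟨b ξ + Y*, c ξ + Z*⟩`, which differs from `⟨Y*, Z*⟩` by the constant `b c`,
in the direction `a ξ + X*`: the `X*` part is computed by the Killing equation. -/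
theorem mvfderiv_inner_actionField (hG : IsRegularCohomogeneityOne J G I M)
    (hξ : IsUnitNormalField J G I ξ) (a b c : ℝ) (X Y Z : GroupLieAlgebra J G) (x : M) :
    mvfderiv I (fun y : M ↦ inner ℝ (actionField J I ξ b Y y) (actionField J I ξ c Z y)) x
        (actionField J I ξ a X x) =
      a * mvfderiv I
          (fun y : M ↦ inner ℝ (fundamentalField J I Y y) (fundamentalField J I Z y)) x (ξ x)
        - inner ℝ (fundamentalField J I ⁅X, Y⁆ x) (fundamentalField J I Z x)
        - inner ℝ (fundamentalField J I ⁅X, Z⁆ x) (fundamentalField J I Y x) := by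
  have : CompleteSpace E := FiniteDimensional.complete ℝ E
  have : CompleteSpace EG := FiniteDimensional.complete ℝ EG
  have hd := mdifferentiableAt_inner_fundamentalField (I := I) Y Z x
  have h1 : (fun y : M ↦
      (inner ℝ (actionField J I ξ b Y y) (actionField J I ξ c Z y) : ℝ)) =
      (fun _ ↦ b * c) +
        fun y ↦ inner ℝ (fundamentalField J I Y y) (fundamentalField J I Z y) :=
    funext fun y ↦ inner_actionField_actionField hξ b c Y Z y
  rw [h1, mvfderiv_add mdifferentiableAt_const hd, mvfderiv_const, zero_add, actionField, map_add,
    map_smul, mvfderiv_inner_fundamentalField hG.isometric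
      (mdifferentiableAt_fundamentalField Y x) (mdifferentiableAt_fundamentalField Z x),
    mlieBracket_fundamentalField, mlieBracket_fundamentalField, inner_neg_left, inner_neg_right,
    real_inner_comm (fundamentalField J I ⁅X, Z⁆ x), smul_eq_mul]
  ring

/-- Koszul's formula for the fields `a ξ + X*`. -/
theorem IsLeviCivita.inner_actionField {LC : CovariantDerivative I E (TangentSpace I : M → Type _)}
    (hLC : IsLeviCivita I LC) (hG : IsRegularCohomogeneityOne J G I M)
    (hξ : IsUnitNormalField J G I ξ) (a b c : ℝ) (X Y Z : GroupLieAlgebra J G) (x : M) :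
    2 * inner ℝ (LC (actionField J I ξ b Y) x (actionField J I ξ a X x))
        (actionField J I ξ c Z x) =
      a * mvfderiv I
          (fun y : M ↦ inner ℝ (fundamentalField J I Y y) (fundamentalField J I Z y)) x (ξ x)
        + b * mvfderiv I
          (fun y : M ↦ inner ℝ (fundamentalField J I X y) (fundamentalField J I Z y)) x (ξ x)
        - c * mvfderiv I
          (fun y : M ↦ inner ℝ (fundamentalField J I X y) (fundamentalField J I Y y)) x (ξ x)
        - inner ℝ (fundamentalField J I ⁅X, Y⁆ x) (fundamentalField J I Z x)
        - inner ℝ (fundamentalField J I ⁅X, Z⁆ x) (fundamentalField J I Y x)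
        - inner ℝ (fundamentalField J I ⁅Y, Z⁆ x) (fundamentalField J I X x) := by
  have hskew : ∀ X Y : GroupLieAlgebra J G, fundamentalField J I ⁅X, Y⁆ x =
      -fundamentalField J I ⁅Y, X⁆ x := fun X Y ↦ by
    have h1 := mlieBracket_swap_apply (I := I) (V := actionField J I ξ 0 X)
      (W := actionField J I ξ 0 Y) (x := x)
    rw [mlieBracket_actionField hξ, mlieBracket_actionField hξ] at h1
    exact neg_injective h1
  rw [hLC.koszul (mdifferentiableAt_actionField hξ a X x) (mdifferentiableAt_actionField hξ b Y x)
    (mdifferentiableAt_actionField hξ c Z x), mvfderiv_inner_actionField hG hξ,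
    mvfderiv_inner_actionField hG hξ, mvfderiv_inner_actionField hG hξ,
    mlieBracket_actionField hξ, mlieBracket_actionField hξ, mlieBracket_actionField hξ,
    inner_neg_left, inner_neg_left, inner_neg_left, CohomogeneityOne.inner_actionField hξ,
    CohomogeneityOne.inner_actionField hξ, CohomogeneityOne.inner_actionField hξ, hskew Y X,
    hskew Z X, hskew Z Y, inner_neg_left, inner_neg_left, inner_neg_left]
  ring

end ActionField

/-! ### The canonical connection on action fields -/

section CanonicalConnection

variable {EG : Type*} [NormedAddCommGroup EG] [NormedSpace ℝ EG]
  {HG : Type*} [TopologicalSpace HG] {J : ModelWithCorners ℝ EG HG} [J.Boundaryless]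
  {G : Type*} [TopologicalSpace G] [ChartedSpace HG G] [Group G] [LieGroup J ∞ G]
  {E : Type*} [NormedAddCommGroup E] [NormedSpace ℝ E] [FiniteDimensional ℝ E]
  {H : Type*} [TopologicalSpace H] {I : ModelWithCorners ℝ E H} [I.Boundaryless]
  {M : Type*} [TopologicalSpace M] [T2Space M] [ChartedSpace H M] [IsManifold I ∞ M]
  [RiemannianBundle (fun x : M ↦ TangentSpace I x)]
  [MulAction G M] [ContMDiffSMul J I ∞ G M]
  {ξ : Π x : M, TangentSpace I x} {φ : ℝ → M → M} {p : M}
  {𝔪 : Submodule ℝ (GroupLieAlgebra J G)}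

theorem push_eq_fundamentalField (hG : IsRegularCohomogeneityOne J G I M)
    (hξ : IsUnitNormalField J G I ξ) (hφ : IsGlobalFlow I ξ φ) (p : M) (t : ℝ)
    (X : GroupLieAlgebra J G) : push J I φ p t X = fundamentalField J I X (φ t p) :=
  mfderiv_flow_fundamentalField hG hξ hφ X t p

omit [J.Boundaryless] [LieGroup J ∞ G] [FiniteDimensional ℝ E]
  [I.Boundaryless] [T2Space M] [IsManifold I ∞ M]
  [RiemannianBundle (fun x : M ↦ TangentSpace I x)] [ContMDiffSMul J I ∞ G M] in
/-- Passing to the `𝔪`-component changes a vector by an element of the isotropy algebra, whose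
fundamental field vanishes at `p`. -/
theorem fundamentalField_mComponent (h𝔪 : IsReductiveComplement J I φ p 𝔪)
    (X : GroupLieAlgebra J G) :
    fundamentalField J I (mComponent J I h𝔪 X) p = fundamentalField J I X p := by
  have h1 : X - mComponent J I h𝔪 X ∈ isotropyAlgebra J I p := by
    rw [← Submodule.projection_apply_eq_zero_iff h𝔪.isCompl, map_sub, sub_eq_zero]
    exact (Submodule.projection_apply_of_mem_left h𝔪.isCompl
      (Submodule.projection_apply_mem h𝔪.isCompl X)).symm
  have h2 : mfderiv J I (fun g : G ↦ g • p) 1 (X - mComponent J I h𝔪 X) = 0 := h1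
  rw [map_sub] at h2
  exact (sub_eq_zero.1 h2).symm

/-- `φ_{t*} X_𝔪` is the value of `X*` on the orbit of `p` under the flow, for any `X` in the Lie
algebra. -/
theorem push_mComponent (hG : IsRegularCohomogeneityOne J G I M)
    (hξ : IsUnitNormalField J G I ξ) (hφ : IsGlobalFlow I ξ φ)
    (h𝔪 : IsReductiveComplement J I φ p 𝔪) (t : ℝ) (X : GroupLieAlgebra J G) :
    push J I φ p t (mComponent J I h𝔪 X) = fundamentalField J I X (φ t p) := by
  rw [← push_eq_fundamentalField hG hξ hφ, push, push, fundamentalField_mComponent]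

theorem mfderiv_flow_actionField (hG : IsRegularCohomogeneityOne J G I M)
    (hξ : IsUnitNormalField J G I ξ) (hφ : IsGlobalFlow I ξ φ) (a : ℝ) (X : GroupLieAlgebra J G)
    (t : ℝ) (x : M) :
    mfderiv I I (φ t) x (actionField J I ξ a X x) = actionField J I ξ a X (φ t x) := by
  rw [actionField, map_add, map_smul, mfderiv_flow_self hG hξ hφ,
    mfderiv_flow_fundamentalField hG hξ hφ, actionField]

variable [FiniteDimensional ℝ EG]

/-- The canonical connection on the fields `a ξ + X*`: at `p` this is the defining property, and it
propagates along the orbit of `p` under the flow since both sides are invariant. -/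
theorem IsCanonicalConnection.actionField
    {can : CovariantDerivative I E (TangentSpace I : M → Type _)}
    (hcan : IsCanonicalConnection J I ξ φ p 𝔪 can) (hG : IsRegularCohomogeneityOne J G I M)
    (hξ : IsUnitNormalField J G I ξ) (hφ : IsGlobalFlow I ξ φ) (a b : ℝ)
    {X : GroupLieAlgebra J G} (hX : X ∈ 𝔪) (Y : GroupLieAlgebra J G) (t : ℝ) :
    can (CohomogeneityOne.actionField J I ξ b Y) (φ t p)
        (CohomogeneityOne.actionField J I ξ a X (φ t p)) =
      -fundamentalField J I ⁅X, Y⁆ (φ t p) := by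
  have hinv := hcan.invariant t (1 : G)
  have h1 : (fun x : M ↦ φ t ((1 : G) • x)) = φ t := by
    ext x
    rw [one_smul]
  rw [h1] at hinv
  have h2 := hinv (CohomogeneityOne.actionField J I ξ b Y) p
    (CohomogeneityOne.actionField J I ξ a X p) (mdifferentiableAt_actionField hξ b Y _)
  rw [mpullback_flow hG hξ hφ (fun x ↦ mfderiv_flow_actionField hG hξ hφ b Y t x),
    mfderiv_flow_actionField hG hξ hφ,
    hcan.nomizu a X hX _ (mdifferentiableAt_actionField hξ b Y p),
    mlieBracket_actionField hξ, map_neg, mfderiv_flow_fundamentalField hG hξ hφ] at h2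
  exact h2.symm

end CanonicalConnection

end CohomogeneityOne

open CohomogeneityOne in
theorem mainTheorem3
    {EG : Type*} [NormedAddCommGroup EG] [NormedSpace ℝ EG] [FiniteDimensional ℝ EG]
    {HG : Type*} [TopologicalSpace HG] (J : ModelWithCorners ℝ EG HG) [J.Boundaryless]
    {G : Type*} [TopologicalSpace G] [ChartedSpace HG G] [Group G] [LieGroup J ∞ G]
    {E : Type*} [NormedAddCommGroup E] [NormedSpace ℝ E] [FiniteDimensional ℝ E]
    {H : Type*} [TopologicalSpace H] (I : ModelWithCorners ℝ E H) [I.Boundaryless]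
    {M : Type*} [TopologicalSpace M] [T2Space M] [ChartedSpace H M] [IsManifold I ∞ M]
    [RiemannianBundle (fun x : M ↦ TangentSpace I x)]
    [IsContMDiffRiemannianBundle I ∞ E (fun x : M ↦ TangentSpace I x)]
    [MulAction G M] [ContMDiffSMul J I ∞ G M]
    (hG : IsRegularCohomogeneityOne J G I M)
    (ξ : Π x : M, TangentSpace I x) (hξ : IsUnitNormalField J G I ξ)
    (φ : ℝ → M → M) (hφ : IsGlobalFlow I ξ φ)
    (p : M) (𝔪 : Submodule ℝ (GroupLieAlgebra J G)) (h𝔪 : IsReductiveComplement J I φ p 𝔪)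
    (LC : CovariantDerivative I E (TangentSpace I : M → Type _)) (hLC : IsLeviCivita I LC)
    (can : CovariantDerivative I E (TangentSpace I : M → Type _))
    (hcan : IsCanonicalConnection J I ξ φ p 𝔪 can) :
    -- the canonical connection along the normal geodesic
    (∀ X ∈ 𝔪, ∀ Y ∈ 𝔪, ∀ t : ℝ,
      can (fundamentalField J I X) (φ t p) (ξ (φ t p)) = 0 ∧
      can ξ (φ t p) (fundamentalField J I X (φ t p)) = 0 ∧
      can ξ (φ t p) (ξ (φ t p)) = 0 ∧
      can (fundamentalField J I Y) (φ t p) (fundamentalField J I X (φ t p))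
        = - push J I φ p t (mComponent J I h𝔪 ⁅X, Y⁆)) ∧
    -- the functions that are differentiated in the formula are differentiable
    (∀ X ∈ 𝔪, ∀ Y ∈ 𝔪,
      Differentiable ℝ (fun t : ℝ ↦ (inner ℝ (push J I φ p t X) (push J I φ p t Y) : ℝ))) ∧
    -- the formula for the difference tensor `S`; `S_u v = LC.difference can x v u`
    (∀ X ∈ 𝔪, ∀ Y ∈ 𝔪, ∀ Z ∈ 𝔪, ∀ a b c t : ℝ,
      2 * inner ℝ
          (LC.difference can (φ t p) (actionField J I ξ b Y (φ t p))
            (actionField J I ξ a X (φ t p)))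
          (actionField J I ξ c Z (φ t p))
        = a * deriv (fun s : ℝ ↦ (inner ℝ (push J I φ p s Y) (push J I φ p s Z) : ℝ)) t
          + b * deriv (fun s : ℝ ↦ (inner ℝ (push J I φ p s X) (push J I φ p s Z) : ℝ)) t
          - c * deriv (fun s : ℝ ↦ (inner ℝ (push J I φ p s X) (push J I φ p s Y) : ℝ)) t
          + inner ℝ (push J I φ p t (mComponent J I h𝔪 ⁅X, Y⁆)) (push J I φ p t Z)
          - inner ℝ (push J I φ p t (mComponent J I h𝔪 ⁅X, Z⁆)) (push J I φ p t Y)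
          - inner ℝ (push J I φ p t (mComponent J I h𝔪 ⁅Y, Z⁆)) (push J I φ p t X)) := by
  have : LieGroup J (minSmoothness ℝ 3) G := lieGroup_minSmoothness
  have : CompleteSpace EG := FiniteDimensional.complete ℝ EG
  have hpush := push_eq_fundamentalField (J := J) hG hξ hφ p
  have hm := push_mComponent hG hξ hφ h𝔪
  have hfield : ∀ X : GroupLieAlgebra J G, actionField J I ξ 0 X = fundamentalField J I X :=
    fun X ↦ funext fun x ↦ by rw [actionField, zero_smul, zero_add]
  have hzero : ∀ x : M, fundamentalField J I (0 : GroupLieAlgebra J G) x = 0 :=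
    fun x ↦ map_zero (mfderiv J I (fun g : G ↦ g • x) 1)
  have hnormal : actionField J I ξ 1 (0 : GroupLieAlgebra J G) = ξ :=
    funext fun x ↦ by rw [actionField, one_smul, hzero, add_zero]
  have hderiv : ∀ (Y Z : GroupLieAlgebra J G) (t : ℝ),
      HasDerivAt (fun s : ℝ ↦ (inner ℝ (push J I φ p s Y) (push J I φ p s Z) : ℝ))
        (mvfderiv I (fun y : M ↦ inner ℝ (fundamentalField J I Y y) (fundamentalField J I Z y))
          (φ t p) (ξ (φ t p))) t := by
    intro Y Z t
    simp only [hpush]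
    exact hasDerivAt_comp_curve (γ := fun s ↦ φ s p) rfl
      (mdifferentiableAt_inner_fundamentalField Y Z _)
      (hφ.integralCurve p t).mdifferentiableAt (mfderiv_integralCurve (hφ.integralCurve p) t)
  refine ⟨fun X hX Y _ t ↦ ⟨?_, ?_, ?_, ?_⟩,
    fun X _ Y _ t ↦ (hderiv X Y t).differentiableAt, ?_⟩
  · have h1 := hcan.actionField hG hξ hφ 1 0 𝔪.zero_mem X t
    rwa [hfield, hnormal, zero_lie, hzero, neg_zero] at h1
  · have h1 := hcan.actionField hG hξ hφ 0 1 hX 0 t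
    rwa [hfield, hnormal, lie_zero, hzero, neg_zero] at h1
  · have h1 := hcan.actionField hG hξ hφ 1 1 𝔪.zero_mem 0 t
    rwa [hnormal, lie_zero, hzero, neg_zero] at h1
  · have h1 := hcan.actionField hG hξ hφ 0 0 hX Y t
    rwa [hfield, hfield, ← hm t ⁅X, Y⁆] at h1
  · intro X hX Y _ Z _ a b c t
    rw [(hderiv Y Z t).deriv, (hderiv X Z t).deriv, (hderiv X Y t).deriv, hm, hm, hm, hpush, hpush,
      hpush]
    have h1 : LC.difference can (φ t p) (actionField J I ξ b Y (φ t p)) =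
        LC (actionField J I ξ b Y) (φ t p) - can (actionField J I ξ b Y) (φ t p) :=
      IsCovariantDerivativeOn.difference_apply LC.isCovariantDerivativeOnUniv
        can.isCovariantDerivativeOnUniv trivial (mdifferentiableAt_actionField hξ b Y (φ t p))
    have h2 := hLC.inner_actionField hG hξ a b c X Y Z (φ t p)
    rw [h1, sub_apply, hcan.actionField hG hξ hφ a b hX Y t, inner_sub_left,
      mul_sub, h2, inner_neg_left, inner_actionField hξ]
    ring
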